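/- Let $d,m\ge 1$ and let $M_p$ be the set of point measures on $\mathbb R^d\times\{1,\dots,m\}$ (Borel measures with values in $\{0,1,2,\dots\}$ on relatively compact Borel sets), with the vague topology, its Borel $\sigma$-algebra and the translation action $T_t$ of $\mathbb R^d$. For $\lambda\in M_p$ let $\lambda^i$ be its part of colour $i$, regarded as a measure on $\mathbb R^d$. Write $C_R\subset\mathbb R^d$ for the open cube of edge length $R$ centred at $0$, and $\ell$ for Lebesgue measure. Let $\mu$ be a Borel probability measure on $M_p$ such that - there is $r>0$ such that every $\lambda$ in the support $X$ of $\mu$ satisfies $\lambda((a+C_r)\times\{1,\dots,m\})\le 1$ for all $a\in\mathbb R^d$; - $\mu$ is invariant and ergodic under the translation action of $\mathbb R^d$; - for each colour $i$ the intensity $I^{(i)}=\int\lambda^i(C_1)\,d\mu(\lambda)$ is positive. Let $w_1,\dots,w_m$ be pairwise distinct nonzero real numbers, and put $\lambda^w=\sum_i w_i\lambda^i$ and $N^w_f(\lambda)=\int f\,d\lambda^w$. The $w$-weighted Palm measure is the signed measure $$\dot\mu^w(D)=\frac1{\ell(B)}\int_X\sum_{x\in B}\lambda^w(\{x\})\,\mathbf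 1_D(T_{-x}\lambda)\,d\mu(\lambda),$$ which is independent of the choice of the bounded Borel set $B$ with $\ell(B)>0$ (for instance $B=C_1$). Its $w$-weighted first moment is $\dot\mu^w_1(f)=\int N^w_f\,d\dot\mu^w$. Then $\dot\mu^w_1$ has a unique Fourier transform that is a positive measure, that is, there is exactly one locally finite positive Borel measure $\widehat{\dot\mu^w_1}$ on $\mathbb R^d$ that integrates all Schwartz functions and satisfies $\int f\,d\widehat{\dot\mu^w_1}=\dot\mu^w_1(\widehat f)$ for every Schwartz function $f$, where $\widehat f(k)=\int f(x)e^{-2\pi i k\cdot x}\,dx$. This measure, the diffraction, is pure point (carried by a countable set) if and only if the dynamical system $(X,\mu)$ has pure point spectrum, meaning that the linear span of the eigenfunctions is dense in $L^2(X,\mu)$. Here an eigenfunction is a nonzero $f\in L^2(X,\mu)$ for which there is $k\in\mathbb R^d$ such that for every $t\in\mathbb R^d$ one has $f(T_{-t}\lambda)=e^{2\pi i k\cdot t}f(\lambda)$ for $\mu$-almost every $\lambda$. -/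

import Mathlib

open MeasureTheory Set
open scoped ENNReal CompactlySupported SchwartzMap FourierTransform

noncomputable section

namespace PointProc

/-- Euclidean space `ℝ^d`. -/
abbrev Space (d : ℕ) : Type := EuclideanSpace ℝ (Fin d)

/-- The space `ℝ^d × {1, …, m}` of points of `ℝ^d` with one of `m` colours. -/
abbrev ColSpace (d m : ℕ) : Type := Space d × Fin m

/-- Translation of a coloured point by `t`. -/
def colTranslate {d m : ℕ} (t : Space d) (p : ColSpace d m) : ColSpace d m := (t + p.1, p.2)

theorem continuous_colTranslate {d m : ℕ} (t : Space d) :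
    Continuous (colTranslate t : ColSpace d m → ColSpace d m) := by
  unfold colTranslate
  fun_prop

theorem measurable_colTranslate {d m : ℕ} (t : Space d) :
    Measurable (colTranslate t : ColSpace d m → ColSpace d m) :=
  (continuous_colTranslate t).measurable

/-- Translations are homeomorphisms. -/
def colTranslateHomeomorph {d m : ℕ} (t : Space d) : ColSpace d m ≃ₜ ColSpace d m where
  toFun := colTranslate t
  invFun := colTranslate (-t)
  left_inv p := by simp [colTranslate]
  right_inv p := by simp [colTranslate]
  continuous_toFun := continuous_colTranslate t
  continuous_invFun := continuous_colTranslate (-t)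

/-- The set `M_p` of point measures: Borel measures taking values in `ℕ` on all relatively compact
Borel sets (regularity is automatic on this space). -/
@[ext]
structure PointMeasure (d m : ℕ) where
  toMeasure : Measure (ColSpace d m)
  exists_nat : ∀ A : Set (ColSpace d m), MeasurableSet A → IsCompact (closure A) →
    ∃ n : ℕ, toMeasure A = n

variable {d m : ℕ}

/-- The vague topology: the coarsest topology making all `lam ↦ ∫ f d(lam)`, `f` continuous with
compact support, continuous. -/
instance : TopologicalSpace (PointMeasure d m) :=
  TopologicalSpace.induced
    (fun (lam : PointMeasure d m) (f : C_c(ColSpace d m, ℝ)) => ∫ p, f p ∂lam.toMeasure)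
    inferInstance

/-- The Borel σ-algebra of the vague topology. -/
instance : MeasurableSpace (PointMeasure d m) := borel _

instance : BorelSpace (PointMeasure d m) := ⟨rfl⟩

/-- Translation of point measures: `(T_t lam)(A) = lam(-t + A)`. -/
instance : AddAction (Space d) (PointMeasure d m) where
  vadd t lam :=
    { toMeasure := lam.toMeasure.map (colTranslate t)
      exists_nat := by
        intro A hA hc
        obtain ⟨n, hn⟩ := lam.exists_nat (colTranslate t ⁻¹' A) (measurable_colTranslate t hA) (by
          have h := (colTranslateHomeomorph (m := m) t).isCompact_preimage.2 hc
          rw [(colTranslateHomeomorph (m := m) t).preimage_closure] at h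
          exact h)
        exact ⟨n, by rw [Measure.map_apply (measurable_colTranslate t) hA, hn]⟩ }
  zero_vadd lam := by
    apply PointMeasure.ext
    change lam.toMeasure.map (colTranslate 0) = lam.toMeasure
    have h : (colTranslate 0 : ColSpace d m → ColSpace d m) = id := by
      funext p
      simp [colTranslate]
    rw [h, Measure.map_id]
  add_vadd s t lam := by
    apply PointMeasure.ext
    change lam.toMeasure.map (colTranslate (s + t))
      = (lam.toMeasure.map (colTranslate t)).map (colTranslate s)
    rw [Measure.map_map (measurable_colTranslate s) (measurable_colTranslate t)]
    congr 1
    funext p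
    simp [colTranslate, add_assoc]

/-- The part `lam^i` of colour `i` of a point measure, as a measure on `ℝ^d`. -/
def PointMeasure.colour (lam : PointMeasure d m) (i : Fin m) : Measure (Space d) :=
  lam.toMeasure.comap (fun x => (x, i))

/-- The open cube `C_R` of edge length `R` centred at `0`. -/
def cube (d : ℕ) (R : ℝ) : Set (Space d) := {x | ∀ j, |x j| < R / 2}

/-- The point measures `lam` with `lam((a + C_r) × {1, …, m}) ≤ 1` for all `a`; they correspond to
the `r`-uniformly discrete subsets of `ℝ^d × {1, …, m}`. -/
def uniformlyDiscrete (d m : ℕ) (r : ℝ) : Set (PointMeasure d m) :=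
  {lam | ∀ a : Space d, lam.toMeasure (((fun x => a + x) '' cube d r) ×ˢ univ) ≤ 1}

/-- The intensity `I^(i)` of the points of colour `i`: their expected number in the cube `C_1` of
volume one. -/
def intensity (μ : Measure (PointMeasure d m)) (i : Fin m) : ℝ≥0∞ :=
  ∫⁻ lam, lam.colour i (cube d 1) ∂μ

/-- The Palm measure with respect to the points of colour `i`,
`D ↦ ∫ ∑_{x ∈ B} lam^i({x}) 1_D(T_{-x} lam) dμ(lam) / ℓ(B)`, with `B = C_1` of volume one. -/
def palm (μ : Measure (PointMeasure d m)) (i : Fin m) : Measure (PointMeasure d m) :=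
  μ.bind fun lam => ((lam.colour i).restrict (cube d 1)).map fun x : Space d => (-x) +ᵥ lam

/-- The integral of `F` against the `w`-weighted Palm measure, the signed combination
`∑ i, w_i • palm μ i`. -/
def weightedPalmIntegral (μ : Measure (PointMeasure d m)) (w : Fin m → ℝ)
    (F : PointMeasure d m → ℂ) : ℂ :=
  ∑ i, (w i : ℂ) * ∫ lam, F lam ∂(palm μ i)

/-- `N^w_f(lam) = lam^w(f)`, where `lam^w = ∑ j, w_j lam^j`. -/
def weightedCount (w : Fin m → ℝ) (f : Space d → ℂ) (lam : PointMeasure d m) : ℂ :=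
  ∑ j, (w j : ℂ) * ∫ x, f x ∂(lam.colour j)

/-- The `w`-weighted first moment of the `w`-weighted Palm measure (the autocorrelation), as a
functional: `f` is mapped to the integral of `N^w_f` against the weighted Palm measure. -/
def weightedFirstMoment (μ : Measure (PointMeasure d m)) (w : Fin m → ℝ)
    (f : Space d → ℂ) : ℂ :=
  weightedPalmIntegral μ w (weightedCount w f)

/-- The positive measure `ν` on `ℝ^d` is the Fourier transform of the weighted first moment of the
weighted Palm measure: `ν(f) = (weighted first moment)(f̂)` for all rapidly decreasing `f`. -/
structure IsDiffraction (μ : Measure (PointMeasure d m)) (w : Fin m → ℝ)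
    (ν : Measure (Space d)) : Prop where
  locallyFinite : IsLocallyFiniteMeasure ν
  integrable : ∀ f : 𝓢(Space d, ℂ), Integrable f ν
  integral_eq : ∀ f : 𝓢(Space d, ℂ),
    ∫ k, f k ∂ν = weightedFirstMoment μ w (𝓕 (f : Space d → ℂ))

/-- A measure is pure point if it is carried by a countable set. -/
def IsPurePoint (ν : Measure (Space d)) : Prop :=
  ∃ S : Set (Space d), S.Countable ∧ ν Sᶜ = 0

/-- `f` is an eigenfunction: `f ≠ 0` and for some `k`, `T_t f = exp(2πi k⬝t) f` in `L²` for all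
`t`, where `(T_t f)(lam) = f(T_{-t} lam)`. -/
def IsEigenfunction (μ : Measure (PointMeasure d m)) (f : Lp ℂ 2 μ) : Prop :=
  f ≠ 0 ∧ ∃ k : Space d, ∀ t : Space d,
    (fun lam => f ((-t) +ᵥ lam)) =ᵐ[μ]
      fun lam => Complex.exp (2 * Real.pi * Complex.I * (inner ℝ k t : ℝ)) * f lam

/-- The dynamical system of `μ` is pure point: the linear span of the eigenfunctions is dense in
`L²`. The support `X` of `μ` has full measure, so `L²(μ)` is `L²(X, μ)`. -/
def HasPurePointSpectrum (μ : Measure (PointMeasure d m)) : Prop :=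
  Dense (Submodule.span ℂ {f : Lp ℂ 2 μ | IsEigenfunction μ f} : Set (Lp ℂ 2 μ))

end PointProc

end

noncomputable section

namespace PointProc

open Topology Filter

/-! ### Measurability in the vague topology. -/

section Vague

variable {d m : ℕ}

/-! The proof compares two unitary representations of `ℝ^d`: translations on `L²(μ)` and
multiplication by characters on `L²(ν)`, where `ν` is the diffraction. Stationarity gives Campbell's
formula for pairs of points (`lintegral_pairs`). With Plancherel it turns the covariance of the
counts `N^w_ĝ` and `N^w_f̂` into the weighted first moment of the Palm measure, evaluated at the
Fourier transform of `conj g * f` (`integral_conj_fourierCount_mul`). So the functional that should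
be `ν` is nonnegative on squares `|g|²`. Uniform discreteness bounds it on all translates of a given
square, and a Bochner–Schwartz argument (`IsPositiveOnSquares.exists_measure_schwartz`) produces
`ν`.

The same identity says that `f ↦ N^w_f̂` extends to an isometry `θ : L²(ν) → L²(μ)`. Modulating `f`
translates the configuration, so `θ` intertwines the two representations
(`IsDiffraction.exists_isometry`).

If the eigenfunctions span `L²(μ)`, the adjoint of `θ` maps each of them to a joint eigenvector of
the multiplications by characters, and such a vector is concentrated in one point. Hence the
indicator of a set without atoms is sent by `θ` to a vector orthogonal to all eigenfunctions, and it
vanishes (`isPurePoint_of_isometry`).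

Conversely, if `ν` is pure point, the indicators of its atoms span `L²(ν)`, and the range of `θ`
lies in the closed span `E` of the eigenfunctions (`isometry_mem_eigenSpan`). This range is in
general much smaller than `L²(μ)`; the gap is closed by multiplication. By ergodicity eigenfunctions
have constant modulus, so the bounded functions in `E` form an algebra (`mulBounded_mem_eigenSpan`).
It is closed under bounded pointwise limits, so the sets with indicator in `E` form a σ-algebra. A
ball of radius `r / 2` holds at most one point, so the weighted count in an open subset takes only
the values `0, w_1, …, w_m`. As these are distinct, Lagrange interpolation recovers from it the
indicator of a point of given colour. Such events generate the Borel sets, so `E` contains all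
indicators and is `L²(μ)` (`hasPurePointSpectrum_of_fourierCountLp`). -/

instance (lam : PointMeasure d m) : IsFiniteMeasureOnCompacts lam.toMeasure where
  lt_top_of_isCompact K hK := by
    obtain ⟨n, hn⟩ := lam.exists_nat K hK.measurableSet (by rwa [hK.isClosed.closure_eq])
    rw [hn]
    exact ENNReal.natCast_lt_top n

theorem PointMeasure.integrable_compactlySupported (lam : PointMeasure d m)
    (f : C_c(ColSpace d m, ℝ)) : Integrable f lam.toMeasure :=
  f.continuous.integrable_of_hasCompactSupport f.hasCompactSupport

theorem PointMeasure.continuous_integral (f : C_c(ColSpace d m, ℝ)) :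
    Continuous fun lam : PointMeasure d m => ∫ p, f p ∂lam.toMeasure :=
  (continuous_apply f).comp (continuous_induced_dom
    (f := fun (lam : PointMeasure d m) (f : C_c(ColSpace d m, ℝ)) => ∫ p, f p ∂lam.toMeasure))

/-- Compactly supported cut-off functions, the `n`-th one being `1` on the `n`-th set of a compact
exhaustion of the space of coloured points. -/
theorem exists_cutoff (d m : ℕ) (n : ℕ) : ∃ g : C_c(ColSpace d m, ℝ),
    (∀ p ∈ CompactExhaustion.choice (ColSpace d m) n, g p = 1) ∧ ∀ p, 0 ≤ g p ∧ g p ≤ 1 := by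
  obtain ⟨f, hf, -, hc, h01⟩ := exists_continuous_one_zero_of_isCompact
    ((CompactExhaustion.choice (ColSpace d m)).isCompact n) isClosed_empty (disjoint_empty _)
  exact ⟨⟨f, hc⟩, fun p hp => hf hp, fun p => h01 p⟩

/-- The compactly supported cut-off functions of `exists_cutoff`. -/
def cutoff (d m : ℕ) (n : ℕ) : C_c(ColSpace d m, ℝ) := (exists_cutoff d m n).choose

theorem cutoff_eq_one {n : ℕ} {p : ColSpace d m}
    (hp : p ∈ CompactExhaustion.choice (ColSpace d m) n) : cutoff d m n p = 1 :=
  (exists_cutoff d m n).choose_spec.1 p hp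

theorem cutoff_nonneg (n : ℕ) (p : ColSpace d m) : 0 ≤ cutoff d m n p :=
  ((exists_cutoff d m n).choose_spec.2 p).1

/-- The product of a compactly supported function and a continuous function. -/
def mulContinuous (g : C_c(ColSpace d m, ℝ)) (q : C(ColSpace d m, ℝ)) : C_c(ColSpace d m, ℝ) :=
  ⟨⟨fun p => g p * q p, by fun_prop⟩, g.hasCompactSupport.mul_right⟩

@[simp] theorem mulContinuous_apply (g : C_c(ColSpace d m, ℝ)) (q : C(ColSpace d m, ℝ))
    (p : ColSpace d m) : mulContinuous g q p = g p * q p := rfl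

/-- A countable family of test functions which induces the vague topology. -/
def testFamily (d m : ℕ) (k : Option ℕ × ℕ) : C_c(ColSpace d m, ℝ) :=
  match k.1 with
  | none => cutoff d m k.2
  | some j => mulContinuous (cutoff d m k.2) (TopologicalSpace.denseSeq C(ColSpace d m, ℝ) j)

/-- The space of continuous functions is separable for uniform convergence on compact sets.
Measuring the error against a fixed cut-off makes it integrable for every point measure at once. -/
theorem exists_testFamily_near (f : C_c(ColSpace d m, ℝ)) : ∃ n, ∀ ε > 0, ∃ k,
    ∀ p, |f p - testFamily d m k p| ≤ ε * cutoff d m n p := by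
  obtain ⟨n, hn⟩ := (CompactExhaustion.choice (ColSpace d m)).exists_superset_of_isCompact
    f.hasCompactSupport
  refine ⟨n, fun ε hε => ?_⟩
  set K := tsupport (cutoff d m n)
  have hK : IsCompact K := (cutoff d m n).hasCompactSupport
  have hopen : {q : C(ColSpace d m, ℝ) | ∀ p ∈ K, |f p - q p| < ε} ∈ 𝓝 (f : C(ColSpace d m, ℝ)) := by
    have h := (ContinuousMap.tendsto_iff_forall_isCompact_tendstoUniformlyOn
      (f := (f : C(ColSpace d m, ℝ))) (F := fun q => q) (p := 𝓝 (f : C(ColSpace d m, ℝ)))).1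
      tendsto_id K hK
    have h2 := Metric.tendstoUniformlyOn_iff.1 h ε hε
    filter_upwards [h2] with q hq p hp
    simpa [Real.dist_eq] using hq p hp
  obtain ⟨_, ⟨j, rfl⟩, hq⟩ :=
    ((TopologicalSpace.denseRange_denseSeq C(ColSpace d m, ℝ)).inter_nhds_nonempty hopen)
  refine ⟨(some j, n), fun p => ?_⟩
  have hfp : f p = cutoff d m n p * f p := by
    by_cases hp : p ∈ tsupport f
    · rw [cutoff_eq_one (hn hp), one_mul]
    · simp [image_eq_zero_of_notMem_tsupport hp]
  have heq : f p - testFamily d m (some j, n) p =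
      cutoff d m n p * (f p - TopologicalSpace.denseSeq C(ColSpace d m, ℝ) j p) := by
    rw [mul_sub, ← hfp]; rfl
  rw [heq, abs_mul, abs_of_nonneg (cutoff_nonneg n p), mul_comm ε]
  by_cases hp : p ∈ K
  · exact mul_le_mul_of_nonneg_left (hq p hp).le (cutoff_nonneg n p)
  · simp [image_eq_zero_of_notMem_tsupport hp]

/-- The integrals of the test functions of `testFamily`. -/
def testIntegrals (lam : PointMeasure d m) (k : Option ℕ × ℕ) : ℝ :=
  ∫ p, testFamily d m k p ∂lam.toMeasure

/-- Near a given point measure the integral of a cut-off stays bounded, so the approximation of a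
test function by the countable family is uniform there. This gives second countability and reduces
Borel measurability to countably many integrals. -/
theorem isInducing_testIntegrals : IsInducing (testIntegrals : PointMeasure d m → _) := by
  refine ⟨le_antisymm ?_ ?_⟩
  · rw [← continuous_iff_le_induced]
    exact continuous_pi fun k => PointMeasure.continuous_integral _
  · let T' : TopologicalSpace (PointMeasure d m) :=
      TopologicalSpace.induced testIntegrals inferInstance
    have hT (k) : Continuous[T', _] fun lam : PointMeasure d m => testIntegrals lam k :=
      (continuous_apply k).comp (continuous_induced_dom (f := testIntegrals))
    change T' ≤ TopologicalSpace.induced _ _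
    rw [← continuous_iff_le_induced]
    refine continuous_pi fun f => ?_
    refine continuous_of_locally_uniform_approx_of_continuousAt fun lam₀ u hu => ?_
    obtain ⟨ε, hε, hu⟩ := Metric.mem_uniformity_dist.1 hu
    obtain ⟨n, hn⟩ := exists_testFamily_near f
    -- The added `1` leaves room for the bound to persist in a neighbourhood of `lam₀`.
    set M : ℝ := testIntegrals lam₀ (none, n) + 1
    have hM0 : 0 < M := by
      have : 0 ≤ testIntegrals lam₀ (none, n) := integral_nonneg fun p => cutoff_nonneg n p
      positivity
    obtain ⟨k, hk⟩ := hn (ε / (2 * M)) (by positivity)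
    refine ⟨{lam | testIntegrals lam (none, n) < M},
      (isOpen_lt (hT _) continuous_const).mem_nhds (by simp [M]),
      fun lam => testIntegrals lam k, (hT k).continuousAt, fun lam hlam => hu ?_⟩
    rw [Real.dist_eq]
    calc |∫ p, f p ∂lam.toMeasure - ∫ p, testFamily d m k p ∂lam.toMeasure|
        = |∫ p, (f p - testFamily d m k p) ∂lam.toMeasure| := by
          rw [integral_sub (lam.integrable_compactlySupported _)
            (lam.integrable_compactlySupported _)]
      _ ≤ ∫ p, |f p - testFamily d m k p| ∂lam.toMeasure := abs_integral_le_integral_abs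
      _ ≤ ∫ p, ε / (2 * M) * cutoff d m n p ∂lam.toMeasure :=
          integral_mono ((lam.integrable_compactlySupported _).sub
            (lam.integrable_compactlySupported _)).abs
            ((lam.integrable_compactlySupported _).const_mul _) hk
      _ = ε / (2 * M) * testIntegrals lam (none, n) := by rw [integral_const_mul]; rfl
      _ ≤ ε / (2 * M) * M := by gcongr; exact hlam.le
      _ < ε := by field_simp; linarith

instance : SecondCountableTopology (PointMeasure d m) :=
  isInducing_testIntegrals.secondCountableTopology

/-- A map into the space of point measures is measurable if its integrals against continuous
functions with compact support are. -/
theorem measurable_of_integral {α : Type*} [MeasurableSpace α] {g : α → PointMeasure d m}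
    (h : ∀ f : C_c(ColSpace d m, ℝ), Measurable fun a => ∫ p, f p ∂(g a).toMeasure) :
    Measurable g := by
  -- Countability of the index set matters here: it makes the Borel σ-algebra of the product equal
  -- to the product σ-algebra.
  have hb : borel (PointMeasure d m) =
      MeasurableSpace.comap testIntegrals MeasurableSpace.pi := by
    rw [isInducing_testIntegrals.eq_induced,
      borel_comap, BorelSpace.measurable_eq (α := (Option ℕ × ℕ → ℝ))]
  have hg : @Measurable _ _ _ (MeasurableSpace.comap testIntegrals MeasurableSpace.pi) g :=
    measurable_comap_iff.2 (measurable_pi_iff.2 fun k => h _)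
  rwa [← hb] at hg

/-- The finite measure `g • lam`, where `g` is a cut-off function. -/
def PointMeasure.cut (lam : PointMeasure d m) (n : ℕ) : Measure (ColSpace d m) :=
  lam.toMeasure.withDensity fun p => ENNReal.ofReal (cutoff d m n p)

instance (lam : PointMeasure d m) (n : ℕ) : IsFiniteMeasure (lam.cut n) := by
  refine isFiniteMeasure_withDensity ?_
  have := (lam.integrable_compactlySupported (cutoff d m n)).lintegral_lt_top
  exact this.ne

theorem PointMeasure.cut_apply (lam : PointMeasure d m) (n : ℕ) {A : Set (ColSpace d m)}
    (hA : MeasurableSet A) (hAn : A ⊆ CompactExhaustion.choice (ColSpace d m) n) :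
    lam.cut n A = lam.toMeasure A := by
  rw [PointMeasure.cut, withDensity_apply _ hA,
    setLIntegral_congr_fun (g := fun _ => 1) hA (fun p hp => by simp [cutoff_eq_one (hAn hp)])]
  simp

/-- Indicators of closed sets are limits of continuous functions, and closed sets form a generating
π-system. The cut-off makes the measures finite, as the π-λ argument requires. -/
theorem PointMeasure.measurable_cut (n : ℕ) :
    Measurable fun lam : PointMeasure d m => lam.cut n := by
  have hclosed : ∀ F : Set (ColSpace d m), IsClosed F →
      Measurable fun lam : PointMeasure d m => lam.cut n F := by
    intro F hF
    refine measurable_of_tendsto_metrizable (f := fun k (lam : PointMeasure d m) =>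
      ∫⁻ p, (hF.apprSeq k p : ℝ≥0∞) ∂(lam.cut n)) (fun k => ?_)
      (tendsto_pi_nhds.2 fun lam => HasOuterApproxClosed.tendsto_lintegral_apprSeq hF (lam.cut n))
    have heq (lam : PointMeasure d m) : ∫⁻ p, (hF.apprSeq k p : ℝ≥0∞) ∂(lam.cut n) =
        ENNReal.ofReal (∫ p, mulContinuous (cutoff d m n)
          ⟨fun p => (hF.apprSeq k p : ℝ), by fun_prop⟩ p ∂lam.toMeasure) := by
      rw [PointMeasure.cut, lintegral_withDensity_eq_lintegral_mul _ (by fun_prop) (by fun_prop),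
        ofReal_integral_eq_lintegral_ofReal (lam.integrable_compactlySupported _)
          (ae_of_all _ fun p => mul_nonneg (cutoff_nonneg n p) (by simp))]
      refine lintegral_congr fun p => ?_
      simp [ENNReal.ofReal_mul (cutoff_nonneg n p)]
    simp_rw [heq]
    exact (PointMeasure.continuous_integral _).measurable.ennreal_ofReal
  exact Measurable.measure_of_isPiSystem
    ((BorelSpace.measurable_eq (α := ColSpace d m)).trans borel_eq_generateFrom_isClosed)
    isPiSystem_isClosed (fun F hF => hclosed F hF) (hclosed univ isClosed_univ)

theorem PointMeasure.measurable_toMeasure :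
    Measurable (PointMeasure.toMeasure : PointMeasure d m → _) := by
  refine Measure.measurable_of_measurable_coe _ fun A hA => ?_
  set K := CompactExhaustion.choice (ColSpace d m)
  have hmono : Monotone fun n => A ∩ K n := fun a b hab =>
    inter_subset_inter_right _ (K.subset hab)
  have h (lam : PointMeasure d m) : lam.toMeasure A = ⨆ n, lam.cut n (A ∩ K n) := by
    have h1 (n) : lam.cut n (A ∩ K n) = lam.toMeasure (A ∩ K n) :=
      lam.cut_apply n (hA.inter (K.isCompact n).measurableSet) inter_subset_right
    simp_rw [h1]
    rw [← hmono.measure_iUnion, ← inter_iUnion, K.iUnion_eq, inter_univ]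
  simp_rw [h]
  exact Measurable.iSup fun n => (Measure.measurable_coe
    (hA.inter (K.isCompact n).measurableSet)).comp (PointMeasure.measurable_cut n)

theorem measurableEmbedding_prodMk_fin (i : Fin m) :
    MeasurableEmbedding fun x : Space d => (x, i) :=
  measurableEmbedding_prod_mk_right i

theorem PointMeasure.colour_apply (lam : PointMeasure d m) (i : Fin m) (A : Set (Space d)) :
    lam.colour i A = lam.toMeasure (A ×ˢ {i}) := by
  rw [PointMeasure.colour, (measurableEmbedding_prodMk_fin i).comap_apply]
  congr 1
  ext ⟨x, j⟩
  simp [eq_comm]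

theorem PointMeasure.measurable_colour (i : Fin m) :
    Measurable fun lam : PointMeasure d m => lam.colour i := by
  refine Measure.measurable_of_measurable_coe _ fun A hA => ?_
  simp_rw [PointMeasure.colour_apply]
  exact (Measure.measurable_coe (hA.prod (measurableSet_singleton i))).comp
    PointMeasure.measurable_toMeasure

theorem PointMeasure.toMeasure_apply_eq_sum (lam : PointMeasure d m) {A : Set (ColSpace d m)}
    (hA : MeasurableSet A) :
    lam.toMeasure A = ∑ i, lam.colour i ((fun x => (x, i)) ⁻¹' A) := by
  have h : A = ⋃ i : Fin m, ((fun x => (x, i)) ⁻¹' A) ×ˢ {i} := by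
    ext ⟨x, j⟩; simp
  conv_lhs => rw [h]
  rw [measure_iUnion, tsum_fintype]
  · simp_rw [PointMeasure.colour_apply]
  · intro i j hij
    refine Set.disjoint_left.2 ?_
    rintro ⟨x, k⟩ ⟨-, hx⟩ ⟨-, hy⟩
    exact hij (hx.symm.trans hy)
  · exact fun i => ((measurableEmbedding_prodMk_fin i).measurable hA).prod
      (measurableSet_singleton i)

instance (lam : PointMeasure d m) (i : Fin m) : IsFiniteMeasureOnCompacts (lam.colour i) where
  lt_top_of_isCompact K hK := by
    rw [PointMeasure.colour_apply]
    exact (hK.prod isCompact_singleton).measure_lt_top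

instance (lam : PointMeasure d m) (i : Fin m) : IsLocallyFiniteMeasure (lam.colour i) :=
  isLocallyFiniteMeasure_of_isFiniteMeasureOnCompacts

/-- A map into the space of point measures is measurable if its coloured parts are. -/
theorem measurable_of_colour {α : Type*} [MeasurableSpace α] {g : α → PointMeasure d m}
    (h : ∀ i, Measurable fun a => (g a).colour i) : Measurable g := by
  have hm : Measurable fun a => (g a).toMeasure := by
    refine Measure.measurable_of_measurable_coe _ fun A hA => ?_
    simp_rw [PointMeasure.toMeasure_apply_eq_sum _ hA]
    exact Finset.measurable_sum _ fun i _ => (Measure.measurable_coe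
      ((measurableEmbedding_prodMk_fin i).measurable hA)).comp (h i)
  refine measurable_of_integral fun f => ?_
  simp_rw [integral_eq_lintegral_pos_part_sub_lintegral_neg_part
    (PointMeasure.integrable_compactlySupported _ f)]
  exact ((Measure.measurable_lintegral (by fun_prop)).comp hm).ennreal_toReal.sub
    ((Measure.measurable_lintegral (by fun_prop)).comp hm).ennreal_toReal

theorem PointMeasure.toMeasure_vadd (t : Space d) (lam : PointMeasure d m) :
    (t +ᵥ lam).toMeasure = lam.toMeasure.map (colTranslate t) := rfl

theorem PointMeasure.colour_vadd (t : Space d) (lam : PointMeasure d m) (i : Fin m) :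
    (t +ᵥ lam).colour i = (lam.colour i).map (t + ·) := by
  ext A hA
  rw [Measure.map_apply (by fun_prop) hA, PointMeasure.colour_apply, PointMeasure.colour_apply,
    PointMeasure.toMeasure_vadd, Measure.map_apply (measurable_colTranslate t)
      (hA.prod (measurableSet_singleton i))]
  rfl

/-- The part of colour `i` of a point measure as a kernel. -/
def colourKernel (d m : ℕ) (i : Fin m) : ProbabilityTheory.Kernel (PointMeasure d m) (Space d) :=
  ⟨fun lam => lam.colour i, PointMeasure.measurable_colour i⟩

@[simp] theorem colourKernel_apply (i : Fin m) (lam : PointMeasure d m) :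
    colourKernel d m i lam = lam.colour i := rfl

end Vague

open Topology Filter ProbabilityTheory

/-! ### Kernels, the Palm measure and its first moments. -/

section Kernels

/-- A kernel of measures which are finite on the sets of a countable measurable cover is
s-finite. -/
theorem isSFiniteKernel_of_cover {α β : Type*} [MeasurableSpace α] [MeasurableSpace β]
    (κ : Kernel α β) (A : ℕ → Set β) (hA : ∀ n, MeasurableSet (A n)) (hU : ⋃ n, A n = univ)
    (hfin : ∀ a n, κ a (A n) ≠ ∞) : IsSFiniteKernel κ := by
  set D := disjointed A
  have hD (n) : MeasurableSet (D n) := MeasurableSet.disjointed hA n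
  have hDfin (a n) : κ a (D n) ≠ ∞ := measure_ne_top_of_subset (disjointed_subset A n) (hfin a n)
  -- The masses are finite for each `a` but need not be bounded in `a`. The restriction is therefore
  -- normalised to mass at most one, and the mass is put back as a density.
  let κ' : ℕ → Kernel α β := fun n => ⟨fun a => (κ a (D n))⁻¹ • (κ a).restrict (D n), by
    refine Measure.measurable_of_measurable_coe _ fun s hs => ?_
    simp only [Measure.smul_apply, Measure.restrict_apply hs, smul_eq_mul]
    exact (κ.measurable_coe (hD n)).inv.mul (κ.measurable_coe (hs.inter (hD n)))⟩
  have hκ' (n) : IsFiniteKernel (κ' n) := ⟨1, by simp, fun a => by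
    change ((κ a (D n))⁻¹ • (κ a).restrict (D n)) univ ≤ 1
    simp [ENNReal.inv_mul_le_one]⟩
  have hres (n) : κ.restrict (hD n) = Kernel.withDensity (κ' n) (fun a _ => κ a (D n)) := by
    ext a s hs
    have hm : Measurable (Function.uncurry fun (a : α) (_ : β) => κ a (D n)) :=
      (κ.measurable_coe (hD n)).comp measurable_fst
    rw [Kernel.restrict_apply, Kernel.withDensity_apply _ hm, withDensity_const]
    change _ = κ a (D n) * ((κ a (D n))⁻¹ * (κ a).restrict (D n) s)
    by_cases h0 : κ a (D n) = 0
    · rw [h0, zero_mul, Measure.restrict_eq_zero.2 h0]; rfl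
    · rw [← mul_assoc, ENNReal.mul_inv_cancel h0 (hDfin a n), one_mul]
  have hsum : κ = Kernel.sum fun n => κ.restrict (hD n) := by
    ext a s hs
    simp_rw [Kernel.sum_apply, Kernel.restrict_apply]
    rw [← Measure.restrict_iUnion (disjoint_disjointed A) hD, iUnion_disjointed, hU,
      Measure.restrict_univ]
  rw [hsum]
  have hfinD (n : ℕ) : IsSFiniteKernel (κ.restrict (hD n)) := by
    rw [hres n]
    exact Kernel.IsSFiniteKernel.withDensity _ (fun a _ => hDfin a n)
  infer_instance

end Kernels

variable {d m : ℕ}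

instance (i : Fin m) : IsSFiniteKernel (colourKernel d m i) :=
  isSFiniteKernel_of_cover _ (fun n => CompactExhaustion.choice (Space d) n)
    (fun n => ((CompactExhaustion.choice (Space d)).isCompact n).measurableSet)
    (CompactExhaustion.choice (Space d)).iUnion_eq
    fun lam n => ((CompactExhaustion.choice (Space d)).isCompact n).measure_ne_top
      (μ := lam.colour i)

/-- Joint measurability in the translation and the configuration is what Tonelli needs in Campbell's
formula. The count of a translated configuration is a kernel integral of a jointly measurable
indicator. -/
theorem measurable_vadd_uncurry :
    Measurable fun p : Space d × PointMeasure d m => p.1 +ᵥ p.2 := by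
  refine measurable_of_colour fun i => Measure.measurable_of_measurable_coe _ fun A hA => ?_
  have h (p : Space d × PointMeasure d m) : (p.1 +ᵥ p.2).colour i A =
      (colourKernel d m i).prodMkLeft (Space d) p {x | p.1 + x ∈ A} := by
    rw [PointMeasure.colour_vadd, Measure.map_apply (by fun_prop) hA]; rfl
  simp_rw [h]
  have hm : MeasurableSet {q : (Space d × PointMeasure d m) × Space d | q.1.1 + q.2 ∈ A} :=
    measurableSet_preimage (by fun_prop) hA
  exact Kernel.measurable_kernel_prodMk_left
    (κ := (colourKernel d m i).prodMkLeft (Space d)) hm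

theorem measurable_const_vadd_pointMeasure (t : Space d) :
    Measurable fun lam : PointMeasure d m => t +ᵥ lam :=
  measurable_vadd_uncurry.comp measurable_prodMk_left

instance : MeasurableConstVAdd (Space d) (PointMeasure d m) :=
  ⟨measurable_const_vadd_pointMeasure⟩

theorem isOpen_cube (d : ℕ) (R : ℝ) : IsOpen (cube d R) := by
  simp only [cube, ofPred_forall]
  exact isOpen_iInter_of_finite fun j => isOpen_lt (by fun_prop) continuous_const

theorem measurableSet_cube (d : ℕ) (R : ℝ) : MeasurableSet (cube d R) :=
  (isOpen_cube d R).measurableSet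

/-- The kernel which gives the Palm measure with respect to the points of colour `i`. -/
def palmKernel (d m : ℕ) (i : Fin m) : Kernel (PointMeasure d m) (PointMeasure d m) where
  toFun lam := ((lam.colour i).restrict (cube d 1)).map fun x : Space d => (-x) +ᵥ lam
  measurable' := by
    refine Measure.measurable_of_measurable_coe _ fun s hs => ?_
    have hm : MeasurableSet {q : PointMeasure d m × Space d | q.2 ∈ cube d 1 ∧ -q.2 +ᵥ q.1 ∈ s} := by
      refine (measurable_snd (measurableSet_cube d 1)).inter ?_
      exact (measurable_vadd_uncurry.comp (measurable_snd.neg.prodMk measurable_fst)) hs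
    have h := Kernel.measurable_kernel_prodMk_left (κ := colourKernel d m i) hm
    convert h using 2 with lam
    have hv : Measurable fun x : Space d => (-x) +ᵥ lam :=
      measurable_vadd_uncurry.comp (measurable_id.neg.prodMk measurable_const)
    rw [Measure.map_apply hv hs, Measure.restrict_apply (hv hs), inter_comm]
    rfl

theorem palm_eq_bind (μ : Measure (PointMeasure d m)) (i : Fin m) :
    palm μ i = μ.bind (palmKernel d m i) := rfl

theorem lintegral_palm (μ : Measure (PointMeasure d m)) (i : Fin m)
    {F : PointMeasure d m → ℝ≥0∞} (hF : Measurable F) :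
    ∫⁻ lam, F lam ∂(palm μ i) =
      ∫⁻ lam, ∫⁻ x in cube d 1, F (-x +ᵥ lam) ∂(lam.colour i) ∂μ := by
  rw [palm_eq_bind, Measure.lintegral_bind (palmKernel d m i).aemeasurable hF.aemeasurable]
  refine lintegral_congr fun lam => ?_
  exact lintegral_map hF (measurable_vadd_uncurry.comp (measurable_id.neg.prodMk measurable_const))

/-- The first moment of colour `j` of the Palm measure with respect to colour `i`. -/
def pairMoment (μ : Measure (PointMeasure d m)) (i j : Fin m) : Measure (Space d) :=
  (palm μ i).bind (colourKernel d m j)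

theorem lintegral_pairMoment (μ : Measure (PointMeasure d m)) (i j : Fin m)
    {h : Space d → ℝ≥0∞} (hh : Measurable h) :
    ∫⁻ z, h z ∂(pairMoment μ i j) =
      ∫⁻ lam, ∫⁻ x in cube d 1, ∫⁻ y, h (y - x) ∂(lam.colour j) ∂(lam.colour i) ∂μ := by
  rw [pairMoment, Measure.lintegral_bind (colourKernel d m j).aemeasurable hh.aemeasurable,
    lintegral_palm μ i hh.lintegral_kernel]
  simp_rw [colourKernel_apply, PointMeasure.colour_vadd]
  refine lintegral_congr fun lam => lintegral_congr fun x => ?_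
  rw [lintegral_map hh (by fun_prop)]
  simp_rw [neg_add_eq_sub]

theorem measurable_lintegral_colour {α : Type*} [MeasurableSpace α] (i : Fin m)
    {g : α → PointMeasure d m} (hg : Measurable g) {F : α → Space d → ℝ≥0∞}
    (hF : Measurable (Function.uncurry F)) :
    Measurable fun a => ∫⁻ x, F a x ∂((g a).colour i) :=
  Measurable.lintegral_kernel_prod_right (κ := (colourKernel d m i).comap g hg) hF

theorem volume_cube_one (d : ℕ) : volume (cube d 1) = 1 := by
  have h : cube d 1 = (WithLp.ofLp : Space d → (Fin d → ℝ)) ⁻¹'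
      (Set.pi univ fun _ => Ioo (-(1 / 2)) (1 / 2)) := by
    ext x
    simp [cube, abs_lt]
  rw [h, (PiLp.volume_preserving_ofLp (Fin d)).measure_preimage
    (MeasurableSet.univ_pi fun _ => measurableSet_Ioo).nullMeasurableSet, Real.volume_pi_Ioo]
  norm_num

theorem lintegral_indicator_cube_sub (x : Space d) :
    ∫⁻ a, (cube d 1).indicator (fun _ => (1 : ℝ≥0∞)) (x - a) = 1 := by
  rw [lintegral_sub_left_eq_self (fun a => (cube d 1).indicator (fun _ => (1 : ℝ≥0∞)) a) x,
    lintegral_indicator (measurableSet_cube d 1), setLIntegral_const, one_mul, volume_cube_one]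

/-! ### Campbell's formula. -/

section Campbell

variable (μ : Measure (PointMeasure d m)) [VAddInvariantMeasure (Space d) (PointMeasure d m) μ]

theorem lintegral_vadd_pointMeasure (t : Space d) (F : PointMeasure d m → ℝ≥0∞)
    (hF : Measurable F) : ∫⁻ lam, F (t +ᵥ lam) ∂μ = ∫⁻ lam, F lam ∂μ :=
  (measurePreserving_vadd t μ).lintegral_comp hF

/-- Campbell's formula for pairs of points of a stationary point process. -/
theorem lintegral_pairs [SFinite μ] (i j : Fin m) {F : Space d → Space d → ℝ≥0∞}
    (hF : Measurable (Function.uncurry F)) :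
    ∫⁻ lam, ∫⁻ x, ∫⁻ y, F x (y - x) ∂(lam.colour j) ∂(lam.colour i) ∂μ =
      ∫⁻ z, ∫⁻ a, F a z ∂volume ∂(pairMoment μ i j) := by
  set c : Space d → ℝ≥0∞ := (cube d 1).indicator fun _ => 1 with hc
  have hcm : Measurable c := measurable_const.indicator (measurableSet_cube d 1)
  have hF' {α : Type} [MeasurableSpace α] {u v : α → Space d} (hu : Measurable u)
      (hv : Measurable v) : Measurable fun a => F (u a) (v a) := hF.comp (hu.prodMk hv)
  -- `G a` collects the pairs whose first point lies in the window `a + C_1`. Integration over `a`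
  -- recovers all pairs, since the window has volume one. By stationarity the configuration may be
  -- translated by `a`, which moves the window back to `C_1` and leaves `a` to be integrated out by
  -- Lebesgue measure.
  let G : Space d → PointMeasure d m → ℝ≥0∞ := fun a lam =>
    ∫⁻ x, c (x - a) * ∫⁻ y, F x (y - x) ∂(lam.colour j) ∂(lam.colour i)
  have hGm : Measurable (Function.uncurry G) := by
    refine measurable_lintegral_colour i measurable_snd
      (F := fun (p : Space d × PointMeasure d m) x =>
        c (x - p.1) * ∫⁻ y, F x (y - x) ∂(p.2.colour j)) (Measurable.mul (by fun_prop) ?_)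
    exact measurable_lintegral_colour j (measurable_snd.comp measurable_fst)
      (hF' (by fun_prop) (by fun_prop))
  have hpair (lam : PointMeasure d m) :
      Measurable fun x => ∫⁻ y, F x (y - x) ∂(lam.colour j) :=
    measurable_lintegral_colour j measurable_const (hF' (by fun_prop) (by fun_prop))
  have h1 (lam : PointMeasure d m) :
      ∫⁻ x, ∫⁻ y, F x (y - x) ∂(lam.colour j) ∂(lam.colour i) = ∫⁻ a, G a lam := by
    simp only [G]
    rw [lintegral_lintegral_swap (μ := volume) (ν := lam.colour i)
      (f := fun a x => c (x - a) * ∫⁻ y, F x (y - x) ∂(lam.colour j))]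
    · refine lintegral_congr fun x => ?_
      rw [lintegral_mul_const _ (by fun_prop), lintegral_indicator_cube_sub, one_mul]
    · exact Measurable.aemeasurable (Measurable.mul (by fun_prop) ((hpair lam).comp measurable_snd))
  have h2 (a : Space d) (lam : PointMeasure d m) : G a (a +ᵥ lam) =
      ∫⁻ x, c x * ∫⁻ y, F (a + x) (y - x) ∂(lam.colour j) ∂(lam.colour i) := by
    simp only [G, PointMeasure.colour_vadd]
    rw [lintegral_map ?_ (by fun_prop)]
    · refine lintegral_congr fun x => ?_
      rw [lintegral_map (hF' (by fun_prop) (by fun_prop)) (by fun_prop)]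
      simp
    · have := hpair (a +ᵥ lam)
      rw [PointMeasure.colour_vadd] at this
      exact Measurable.mul (by fun_prop) this
  have h3 (lam : PointMeasure d m) : ∫⁻ a, G a (a +ᵥ lam) =
      ∫⁻ x in cube d 1, ∫⁻ y, ∫⁻ a, F a (y - x) ∂volume ∂(lam.colour j) ∂(lam.colour i) := by
    simp_rw [h2]
    rw [lintegral_lintegral_swap (μ := volume) (ν := lam.colour i)
      (f := fun a x => c x * ∫⁻ y, F (a + x) (y - x) ∂(lam.colour j)),
      ← lintegral_indicator (μ := lam.colour i) (measurableSet_cube d 1)]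
    · refine lintegral_congr fun x => ?_
      rw [lintegral_const_mul, lintegral_lintegral_swap (μ := volume) (ν := lam.colour j)
        (f := fun a y => F (a + x) (y - x))]
      · have ht : ∫⁻ y, ∫⁻ a, F (a + x) (y - x) ∂volume ∂(lam.colour j) =
            ∫⁻ y, ∫⁻ a, F a (y - x) ∂volume ∂(lam.colour j) :=
          lintegral_congr fun y => lintegral_add_right_eq_self (fun a => F a (y - x)) x
        rw [ht]
        by_cases hx : x ∈ cube d 1
        · rw [hc, indicator_of_mem hx, indicator_of_mem hx, one_mul]
        · rw [hc, indicator_of_notMem hx, indicator_of_notMem hx, zero_mul]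
      · exact (hF' (by fun_prop) (by fun_prop)).aemeasurable
      · exact measurable_lintegral_colour j measurable_const (hF' (by fun_prop) (by fun_prop))
    · refine (Measurable.mul (f := fun p : Space d × Space d => c p.2)
        (g := fun p : Space d × Space d => ∫⁻ y, F (p.1 + p.2) (y - p.2) ∂(lam.colour j))
        (by fun_prop) ?_).aemeasurable
      exact measurable_lintegral_colour j measurable_const (hF' (by fun_prop) (by fun_prop))
  have hshift : Measurable fun p : PointMeasure d m × Space d => (p.2, p.2 +ᵥ p.1) :=
    measurable_snd.prodMk (measurable_vadd_uncurry.comp measurable_swap)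
  have hGm' := hGm.comp hshift
  calc ∫⁻ lam, ∫⁻ x, ∫⁻ y, F x (y - x) ∂(lam.colour j) ∂(lam.colour i) ∂μ
      = ∫⁻ lam, (∫⁻ a, G a lam) ∂μ := lintegral_congr h1
    _ = ∫⁻ a, (∫⁻ lam, G a lam ∂μ) :=
        lintegral_lintegral_swap (hGm.comp measurable_swap).aemeasurable
    _ = ∫⁻ a, (∫⁻ lam, G a (a +ᵥ lam) ∂μ) := lintegral_congr fun a =>
        (lintegral_vadd_pointMeasure μ a _ (hGm.comp measurable_prodMk_left)).symm
    _ = ∫⁻ lam, (∫⁻ a, G a (a +ᵥ lam)) ∂μ :=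
        (lintegral_lintegral_swap (f := fun lam a => G a (a +ᵥ lam)) hGm'.aemeasurable).symm
    _ = ∫⁻ lam, ∫⁻ x in cube d 1, ∫⁻ y, ∫⁻ a, F a (y - x) ∂volume ∂(lam.colour j) ∂(lam.colour i) ∂μ :=
        lintegral_congr h3
    _ = ∫⁻ z, ∫⁻ a, F a z ∂volume ∂(pairMoment μ i j) :=
        (lintegral_pairMoment μ i j (h := fun z => ∫⁻ a, F a z)
          (Measurable.lintegral_prod_left (f := fun a z => F a z) hF)).symm

end Campbell

/-! ### Temperate growth of uniformly bounded measures. -/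

section Growth

variable {E : Type*} [NormedAddCommGroup E] [NormedSpace ℝ E]

/-- The weight `(1 + ‖x‖)⁻ⁿ` with `n` one more than the dimension. -/
def decayWeight (x : E) : ℝ := (1 + ‖x‖) ^ (-((Module.finrank ℝ E + 1 : ℕ) : ℝ))

theorem decayWeight_pos (x : E) : 0 < decayWeight x := by unfold decayWeight; positivity

theorem continuous_decayWeight : Continuous (decayWeight : E → ℝ) := by
  unfold decayWeight
  exact Continuous.rpow_const (by fun_prop) fun x => Or.inl (by positivity)

theorem decayWeight_le {ε : ℝ} (hε : 0 < ε) {x y : E} (hxy : dist y x < ε) :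
    decayWeight x ≤ (1 + ε) ^ (Module.finrank ℝ E + 1) * decayWeight y := by
  have h : 1 + ‖y‖ ≤ (1 + ε) * (1 + ‖x‖) := by
    have h1 : ‖y‖ ≤ ‖x‖ + ε := by
      rw [dist_eq_norm] at hxy
      linarith [norm_le_norm_add_norm_sub' y x]
    nlinarith [norm_nonneg x]
  simp only [decayWeight, Real.rpow_neg (add_nonneg zero_le_one (norm_nonneg _)), Real.rpow_natCast]
  rw [← div_eq_mul_inv, le_div_iff₀ (by positivity), inv_mul_le_iff₀ (by positivity), ← mul_pow,
    mul_comm (1 + ‖x‖)]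
  exact pow_le_pow_left₀ (by positivity) h _

theorem exists_norm_le_decayWeight (f : 𝓢(E, ℂ)) : ∃ B : ℝ, 0 ≤ B ∧
    ∀ x, ‖f x‖ ≤ B * decayWeight x := by
  set N := Module.finrank ℝ E + 1
  set S := (Finset.Iic (N, 0)).sup (fun m => SchwartzMap.seminorm ℝ m.1 m.2) f
  refine ⟨2 ^ N * S, by positivity, fun x => ?_⟩
  have h := SchwartzMap.one_add_le_sup_seminorm_apply (𝕜 := ℝ) (m := (N, 0)) le_rfl le_rfl f x
  rw [norm_iteratedFDeriv_zero] at h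
  simp only [decayWeight, Real.rpow_neg (add_nonneg zero_le_one (norm_nonneg _)), Real.rpow_natCast]
  rw [← div_eq_mul_inv, le_div_iff₀ (by positivity), mul_comm]
  exact h

variable [FiniteDimensional ℝ E] [MeasurableSpace E] [BorelSpace E]

theorem integrable_decayWeight (μ : Measure E) [μ.IsAddHaarMeasure] :
    Integrable (decayWeight : E → ℝ) μ :=
  integrable_one_add_norm (by norm_num)

/-- A measure which is bounded by `K` on all balls of radius `ε` integrates the weight
`(1 + ‖x‖)⁻ⁿ`, with a bound depending only on `K` and `ε`. -/
theorem exists_lintegral_decayWeight_le (E : Type*) [NormedAddCommGroup E] [NormedSpace ℝ E]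
    [FiniteDimensional ℝ E] [MeasurableSpace E] [BorelSpace E] {ε : ℝ} (hε : 0 < ε) :
    ∃ C : ℝ≥0∞, C ≠ ∞ ∧ ∀ (ρ : Measure E) [SFinite ρ] (K : ℝ≥0∞),
      (∀ a, ρ (Metric.ball a ε) ≤ K) → ∫⁻ x, ENNReal.ofReal (decayWeight x) ∂ρ ≤ C * K := by
  let vol : Measure E := Measure.addHaar
  set v := vol (Metric.ball 0 ε) with hv
  have hv0 : v ≠ 0 := (Metric.measure_ball_pos vol 0 hε).ne'
  have hvt : v ≠ ∞ := measure_ball_lt_top.ne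
  set c : ℝ≥0∞ := ENNReal.ofReal ((1 + ε) ^ (Module.finrank ℝ E + 1))
  set I : ℝ≥0∞ := ∫⁻ y, ENNReal.ofReal (decayWeight (y : E)) ∂vol
  have hI : I ≠ ∞ := (integrable_decayWeight vol).lintegral_lt_top.ne
  have hdm : Measurable fun x : E => ENNReal.ofReal (decayWeight x) :=
    continuous_decayWeight.measurable.ennreal_ofReal
  refine ⟨v⁻¹ * (c * I), ENNReal.mul_ne_top (ENNReal.inv_ne_top.2 hv0)
    (ENNReal.mul_ne_top ENNReal.ofReal_ne_top hI), fun ρ _ K hK => ?_⟩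
  have hS : MeasurableSet {p : E × E | dist p.1 p.2 < ε} :=
    (isOpen_lt continuous_dist continuous_const).measurableSet
  have hm : Measurable fun p : E × E => {p : E × E | dist p.1 p.2 < ε}.indicator
      (fun p => c * ENNReal.ofReal (decayWeight p.2)) p :=
    ((hdm.comp measurable_snd).const_mul c).indicator hS
  -- The weight at `x` is replaced by an average over the ball around `x`, where it is comparable.
  -- After exchanging the integrals `ρ` enters only through masses of balls.
  have h1 (x : E) : v * ENNReal.ofReal (decayWeight x) ≤
      ∫⁻ y, {p : E × E | dist p.1 p.2 < ε}.indicator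
        (fun p => c * ENNReal.ofReal (decayWeight p.2)) (x, y) ∂vol := by
    calc v * ENNReal.ofReal (decayWeight x)
        = ∫⁻ y in Metric.ball x ε, ENNReal.ofReal (decayWeight x) ∂vol := by
          rw [setLIntegral_const, mul_comm, hv, Measure.addHaar_ball_center vol x]
      _ ≤ ∫⁻ y in Metric.ball x ε, c * ENNReal.ofReal (decayWeight y) ∂vol := by
          refine setLIntegral_mono' measurableSet_ball fun y hy => ?_
          rw [← ENNReal.ofReal_mul (by positivity)]
          exact ENNReal.ofReal_le_ofReal (decayWeight_le hε hy)
      _ = _ := by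
          rw [← lintegral_indicator measurableSet_ball]
          refine lintegral_congr fun y => ?_
          simp only [indicator, Metric.mem_ball, mem_ofPred_eq, dist_comm]
  have h2 (y : E) : ∫⁻ x, {p : E × E | dist p.1 p.2 < ε}.indicator
        (fun p => c * ENNReal.ofReal (decayWeight p.2)) (x, y) ∂ρ ≤
      K * (c * ENNReal.ofReal (decayWeight y)) := by
    have : ∀ x, {p : E × E | dist p.1 p.2 < ε}.indicator
        (fun p => c * ENNReal.ofReal (decayWeight p.2)) (x, y) =
        (Metric.ball y ε).indicator (fun _ => c * ENNReal.ofReal (decayWeight y)) x := by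
      intro x
      simp only [indicator, Metric.mem_ball, mem_ofPred_eq]
    simp_rw [this]
    rw [lintegral_indicator measurableSet_ball, setLIntegral_const, mul_comm]
    gcongr
    exact hK y
  have h3 : v * ∫⁻ x, ENNReal.ofReal (decayWeight x) ∂ρ ≤ K * (c * I) := by
    rw [← lintegral_const_mul _ hdm]
    refine (lintegral_mono h1).trans ?_
    rw [lintegral_lintegral_swap hm.aemeasurable]
    refine (lintegral_mono h2).trans_eq ?_
    rw [lintegral_const_mul _ (by fun_prop), lintegral_const_mul _ hdm]
  rwa [mul_assoc, ← ENNReal.mul_le_iff_le_inv hv0 hvt, mul_comm _ K]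

theorem hasTemperateGrowth_of_ball_le {ρ : Measure E} [SFinite ρ] {ε : ℝ} (hε : 0 < ε)
    {K : ℝ≥0∞} (hK : K ≠ ∞) (h : ∀ a, ρ (Metric.ball a ε) ≤ K) : ρ.HasTemperateGrowth := by
  obtain ⟨C, hC, hρ⟩ := exists_lintegral_decayWeight_le E hε
  refine ⟨⟨Module.finrank ℝ E + 1, continuous_decayWeight.aestronglyMeasurable, ?_⟩⟩
  change HasFiniteIntegral decayWeight ρ
  rw [hasFiniteIntegral_iff_ofReal (ae_of_all _ fun x => (decayWeight_pos x).le)]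
  exact (hρ ρ K h).trans_lt (ENNReal.mul_lt_top hC.lt_top hK.lt_top)

end Growth

/-! ### Uniform bounds from uniform discreteness. -/

section Bounds

variable {d m : ℕ} {r : ℝ}

theorem abs_apply_le_norm (x : Space d) (j : Fin d) : |x j| ≤ ‖x‖ := by
  simpa using PiLp.norm_apply_le x j

theorem colour_ball_le {lam : PointMeasure d m} (h : lam ∈ uniformlyDiscrete d m r) (i : Fin m)
    (a : Space d) : lam.colour i (Metric.ball a (r / 2)) ≤ 1 := by
  rw [PointMeasure.colour_apply]
  refine (measure_mono ?_).trans (h a)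
  refine prod_mono (fun y hy => ⟨y - a, fun j => ?_, by simp⟩) (subset_univ _)
  exact (abs_apply_le_norm _ _).trans_lt (by simpa [dist_eq_norm] using hy)

theorem ae_mem_uniformlyDiscrete {μ : Measure (PointMeasure d m)}
    (hX : μ.support ⊆ uniformlyDiscrete d m r) : ∀ᵐ lam ∂μ, lam ∈ uniformlyDiscrete d m r :=
  Filter.mem_of_superset Measure.support_mem_ae hX

/-- The integral of the weight against the points of one colour is bounded on uniformly discrete
point measures. -/
theorem exists_lintegral_colour_decayWeight_le (d m : ℕ) (hr : 0 < r) :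
    ∃ C : ℝ≥0∞, C ≠ ∞ ∧ ∀ lam ∈ uniformlyDiscrete d m r, ∀ i,
      ∫⁻ x, ENNReal.ofReal (decayWeight x) ∂(lam.colour i) ≤ C := by
  obtain ⟨C, hC, h⟩ := exists_lintegral_decayWeight_le (Space d) (half_pos hr)
  refine ⟨C, hC, fun lam hlam i => ?_⟩
  simpa using h (lam.colour i) 1 (colour_ball_le hlam i)

theorem exists_cube_le_decayWeight (d : ℕ) : ∃ c : ℝ, 0 < c ∧ ∀ x ∈ cube d 1, c ≤ decayWeight x := by
  refine ⟨(1 + √d) ^ (-((Module.finrank ℝ (Space d) + 1 : ℕ) : ℝ)), by positivity, fun x hx => ?_⟩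
  have hn : ‖x‖ ≤ √d := by
    refine Real.le_sqrt_of_sq_le ?_
    rw [EuclideanSpace.norm_sq_eq]
    calc ∑ j, ‖x j‖ ^ 2 ≤ ∑ j : Fin d, (1 : ℝ) := Finset.sum_le_sum fun j _ => by
          have := hx j
          rw [Real.norm_eq_abs]
          nlinarith [abs_nonneg (x j)]
      _ = d := by simp
  exact Real.rpow_le_rpow_of_nonpos (by positivity) (by linarith) 
    (neg_nonpos.2 (Nat.cast_nonneg _))

theorem exists_colour_cube_le (d m : ℕ) (hr : 0 < r) :
    ∃ K : ℝ≥0∞, K ≠ ∞ ∧ ∀ lam ∈ uniformlyDiscrete d m r, ∀ i, lam.colour i (cube d 1) ≤ K := by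
  obtain ⟨C, hC, h⟩ := exists_lintegral_colour_decayWeight_le (r := r) d m hr
  obtain ⟨c, hc, hcube⟩ := exists_cube_le_decayWeight d
  have hc0 : ENNReal.ofReal c ≠ 0 := by simpa using hc
  refine ⟨(ENNReal.ofReal c)⁻¹ * C, ENNReal.mul_ne_top (ENNReal.inv_ne_top.2 hc0) hC,
    fun lam hlam i => ?_⟩
  rw [← ENNReal.mul_le_iff_le_inv hc0 ENNReal.ofReal_ne_top]
  calc ENNReal.ofReal c * lam.colour i (cube d 1)
      = ∫⁻ x in cube d 1, ENNReal.ofReal c ∂(lam.colour i) := by rw [setLIntegral_const]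
    _ ≤ ∫⁻ x in cube d 1, ENNReal.ofReal (decayWeight x) ∂(lam.colour i) :=
        setLIntegral_mono' (measurableSet_cube d 1) fun x hx =>
          ENNReal.ofReal_le_ofReal (hcube x hx)
    _ ≤ ∫⁻ x, ENNReal.ofReal (decayWeight x) ∂(lam.colour i) := setLIntegral_le_lintegral _ _
    _ ≤ C := h lam hlam i

variable {μ : Measure (PointMeasure d m)} [IsProbabilityMeasure μ]

/-- For each point `x` in the unit cube at most one `y` has `y - x` in the given ball, and the
number of such `x` is bounded on uniformly discrete configurations. -/
theorem exists_pairMoment_ball_le (hr : 0 < r) (hX : ∀ᵐ lam ∂μ, lam ∈ uniformlyDiscrete d m r)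
    (i j : Fin m) :
    ∃ K : ℝ≥0∞, K ≠ ∞ ∧ ∀ a, pairMoment μ i j (Metric.ball a (r / 2)) ≤ K := by
  obtain ⟨K, hK, h⟩ := exists_colour_cube_le (r := r) d m hr
  refine ⟨K, hK, fun a => ?_⟩
  rw [← lintegral_indicator_one measurableSet_ball,
    lintegral_pairMoment μ i j (measurable_one.indicator measurableSet_ball)]
  calc _ ≤ ∫⁻ lam, K ∂μ := by
        refine lintegral_mono_ae ?_
        filter_upwards [hX] with lam hlam
        calc _ ≤ ∫⁻ x in cube d 1, 1 ∂(lam.colour i) := by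
              refine lintegral_mono fun x => ?_
              have hb : ∀ y, (Metric.ball a (r / 2)).indicator (1 : Space d → ℝ≥0∞) (y - x) =
                  (Metric.ball (a + x) (r / 2)).indicator 1 y := by
                intro y
                have : y - x ∈ Metric.ball a (r / 2) ↔ y ∈ Metric.ball (a + x) (r / 2) := by
                  simp [dist_eq_norm, sub_sub, add_comm]
                by_cases hy : y - x ∈ Metric.ball a (r / 2)
                · rw [indicator_of_mem hy, indicator_of_mem (this.1 hy)]; rfl
                · rw [indicator_of_notMem hy, indicator_of_notMem (mt this.2 hy)]
              simp_rw [hb]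
              rw [lintegral_indicator_one measurableSet_ball]
              exact colour_ball_le hlam j _
          _ ≤ K := by simpa using h lam hlam i
    _ = K := by simp

end Bounds

theorem integral_bind_kernel {α β E : Type*} [MeasurableSpace α] [MeasurableSpace β]
    [NormedAddCommGroup E] [NormedSpace ℝ E] {μ : Measure α} {κ : Kernel α β} {f : β → E}
    (hf : Integrable f (μ.bind κ)) :
    ∫ b, f b ∂(μ.bind κ) = ∫ a, ∫ b, f b ∂(κ a) ∂μ := by
  rw [Measure.comp_eq_comp_const_apply] at hf ⊢
  rw [ProbabilityTheory.Kernel.integral_comp hf]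
  simp

theorem integrable_integral_of_bind {α β E : Type*} [MeasurableSpace α] [MeasurableSpace β]
    [NormedAddCommGroup E] [NormedSpace ℝ E] {μ : Measure α} {κ : Kernel α β} {f : β → E}
    (hf : Integrable f (μ.bind κ)) : Integrable (fun a => ∫ b, f b ∂(κ a)) μ := by
  rw [Measure.comp_eq_comp_const_apply] at hf
  simpa using hf.integral_comp

/-! ### Pair correlations of complex test functions. -/

section Pairs

variable {d m : ℕ} {r : ℝ} {μ : Measure (PointMeasure d m)} [IsProbabilityMeasure μ]

theorem isLocallyFiniteMeasure_of_ball_le {E : Type*} [PseudoMetricSpace E] [MeasurableSpace E]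
    {ρ : Measure E} {ε : ℝ} (hε : 0 < ε) {K : ℝ≥0∞} (hK : K ≠ ∞)
    (h : ∀ a, ρ (Metric.ball a ε) ≤ K) : IsLocallyFiniteMeasure ρ :=
  ⟨fun a => ⟨Metric.ball a ε, Metric.ball_mem_nhds a hε, (h a).trans_lt hK.lt_top⟩⟩

theorem isLocallyFiniteMeasure_pairMoment (hr : 0 < r)
    (hX : ∀ᵐ lam ∂μ, lam ∈ uniformlyDiscrete d m r) (i j : Fin m) :
    IsLocallyFiniteMeasure (pairMoment μ i j) := by
  obtain ⟨K, hK, h⟩ := exists_pairMoment_ball_le hr hX i j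
  exact isLocallyFiniteMeasure_of_ball_le (half_pos hr) hK h

theorem hasTemperateGrowth_pairMoment (hr : 0 < r)
    (hX : ∀ᵐ lam ∂μ, lam ∈ uniformlyDiscrete d m r) (i j : Fin m) :
    (pairMoment μ i j).HasTemperateGrowth := by
  obtain ⟨K, hK, h⟩ := exists_pairMoment_ball_le hr hX i j
  have := isLocallyFiniteMeasure_pairMoment hr hX i j
  exact hasTemperateGrowth_of_ball_le (half_pos hr) hK h

theorem lintegral_enorm_le_of_decayWeight {E : Type*} [NormedAddCommGroup E] [NormedSpace ℝ E]
    [MeasurableSpace E] {ρ : Measure E} {f : E → ℂ}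
    {B : ℝ} (hB : 0 ≤ B) (hf : ∀ x, ‖f x‖ ≤ B * decayWeight x) {C : ℝ≥0∞}
    (hC : ∫⁻ x, ENNReal.ofReal (decayWeight x) ∂ρ ≤ C) :
    ∫⁻ x, ‖f x‖ₑ ∂ρ ≤ ENNReal.ofReal B * C := by
  calc ∫⁻ x, ‖f x‖ₑ ∂ρ ≤ ∫⁻ x, ENNReal.ofReal B * ENNReal.ofReal (decayWeight x) ∂ρ := by
        refine lintegral_mono fun x => ?_
        rw [← ENNReal.ofReal_mul hB, ← ofReal_norm]
        exact ENNReal.ofReal_le_ofReal (hf x)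
    _ = ENNReal.ofReal B * ∫⁻ x, ENNReal.ofReal (decayWeight x) ∂ρ :=
        lintegral_const_mul' _ _ ENNReal.ofReal_ne_top
    _ ≤ _ := by gcongr

/-- The integrals of a Schwartz function against the points of one colour are bounded, uniformly
over all functions with the same decay. -/
theorem exists_lintegral_colour_le (d m : ℕ) (hr : 0 < r) :
    ∃ C : ℝ≥0∞, C ≠ ∞ ∧ ∀ lam ∈ uniformlyDiscrete d m r, ∀ i, ∀ (f : Space d → ℂ) (B : ℝ),
      0 ≤ B → (∀ x, ‖f x‖ ≤ B * decayWeight x) →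
        ∫⁻ x, ‖f x‖ₑ ∂(lam.colour i) ≤ ENNReal.ofReal B * C := by
  obtain ⟨C, hC, h⟩ := exists_lintegral_colour_decayWeight_le (r := r) d m hr
  exact ⟨C, hC, fun lam hlam i f B hB hf =>
    lintegral_enorm_le_of_decayWeight hB hf (h lam hlam i)⟩

theorem integrable_colour (hr : 0 < r) {lam : PointMeasure d m}
    (hlam : lam ∈ uniformlyDiscrete d m r) (i : Fin m) (f : 𝓢(Space d, ℂ)) :
    Integrable f (lam.colour i) := by
  obtain ⟨C, hC, h⟩ := exists_lintegral_colour_le (r := r) d m hr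
  obtain ⟨B, hB, hf⟩ := exists_norm_le_decayWeight f
  exact ⟨f.continuous.aestronglyMeasurable, (h lam hlam i f B hB hf).trans_lt
    (ENNReal.mul_lt_top ENNReal.ofReal_lt_top hC.lt_top)⟩

/-- The measure of pairs of points of colours `i` and `j`. -/
def pairMeasure (μ : Measure (PointMeasure d m)) (i j : Fin m) : Measure (Space d × Space d) :=
  μ.bind (colourKernel d m i ×ₖ colourKernel d m j)

theorem lintegral_pairMeasure (μ : Measure (PointMeasure d m)) (i j : Fin m)
    {H : Space d × Space d → ℝ≥0∞} (hH : Measurable H) :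
    ∫⁻ p, H p ∂(pairMeasure μ i j) =
      ∫⁻ lam, ∫⁻ x, ∫⁻ y, H (x, y) ∂(lam.colour j) ∂(lam.colour i) ∂μ := by
  rw [pairMeasure, Measure.lintegral_bind (Kernel.aemeasurable _) hH.aemeasurable]
  refine lintegral_congr fun lam => ?_
  rw [Kernel.prod_apply, lintegral_prod _ hH.aemeasurable]
  rfl

theorem integrable_pairMeasure (hr : 0 < r) (hX : ∀ᵐ lam ∂μ, lam ∈ uniformlyDiscrete d m r)
    (i j : Fin m) (f g : 𝓢(Space d, ℂ)) :
    Integrable (fun p => starRingEnd ℂ (g p.1) * f p.2) (pairMeasure μ i j) := by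
  have hc : Continuous fun p : Space d × Space d => starRingEnd ℂ (g p.1) * f p.2 :=
    (RCLike.continuous_conj.comp (g.continuous.comp continuous_fst)).mul
      (f.continuous.comp continuous_snd)
  refine ⟨hc.aestronglyMeasurable, ?_⟩
  obtain ⟨C, hC, h⟩ := exists_lintegral_colour_le (r := r) d m hr
  obtain ⟨B, hB, hf⟩ := exists_norm_le_decayWeight f
  obtain ⟨B', hB', hg⟩ := exists_norm_le_decayWeight g
  rw [HasFiniteIntegral, lintegral_pairMeasure μ i j hc.measurable.enorm]
  have hle : ∫⁻ lam, ∫⁻ x, ∫⁻ y, ‖starRingEnd ℂ (g x) * f y‖ₑ ∂(lam.colour j) ∂(lam.colour i) ∂μ ≤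
      ∫⁻ lam, (ENNReal.ofReal B' * C) * (ENNReal.ofReal B * C) ∂μ := by
    refine lintegral_mono_ae ?_
    filter_upwards [hX] with lam hlam
    have h1 : ∀ x, ∫⁻ y, ‖starRingEnd ℂ (g x) * f y‖ₑ ∂(lam.colour j) ≤
        ‖g x‖ₑ * (ENNReal.ofReal B * C) := by
      intro x
      simp_rw [enorm_mul, RCLike.enorm_conj]
      rw [lintegral_const_mul' _ _ enorm_ne_top]
      gcongr
      exact h lam hlam j f B hB hf
    refine (lintegral_mono h1).trans ?_
    rw [lintegral_mul_const _ g.continuous.measurable.enorm]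
    gcongr
    exact h lam hlam i g B' hB' hg
  refine hle.trans_lt ?_
  rw [lintegral_const, measure_univ, mul_one]
  exact ENNReal.mul_lt_top (ENNReal.mul_lt_top ENNReal.ofReal_lt_top hC.lt_top)
    (ENNReal.mul_lt_top ENNReal.ofReal_lt_top hC.lt_top)

variable [VAddInvariantMeasure (Space d) (PointMeasure d m) μ]

/-- Campbell's formula for indicator functions, read as an identity of measures. In this form it
applies to complex integrands through integrability and Fubini. -/
theorem map_pairMeasure (hr : 0 < r) (hX : ∀ᵐ lam ∂μ, lam ∈ uniformlyDiscrete d m r)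
    (i j : Fin m) : (pairMeasure μ i j).map (fun p => (p.1, p.2 - p.1)) =
      volume.prod (pairMoment μ i j) := by
  have := isLocallyFiniteMeasure_pairMoment hr hX i j
  have hT : Measurable fun p : Space d × Space d => (p.1, p.2 - p.1) := by fun_prop
  ext A hA
  have hA1 : Measurable (A.indicator (1 : Space d × Space d → ℝ≥0∞)) := measurable_one.indicator hA
  rw [← lintegral_indicator_one hA, lintegral_map hA1 hT,
    lintegral_pairMeasure μ i j (H := fun p => A.indicator 1 (p.1, p.2 - p.1)) (hA1.comp hT),
    lintegral_pairs μ i j (F := fun a z => A.indicator 1 (a, z)) hA1,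
    ← lintegral_indicator_one hA, lintegral_prod_symm _ hA1.aemeasurable]

theorem integral_conj_mul_colour (lam : PointMeasure d m) (i j : Fin m) (f g : Space d → ℂ) :
    ∫ p, starRingEnd ℂ (g p.1) * f p.2 ∂((colourKernel d m i ×ₖ colourKernel d m j) lam) =
      starRingEnd ℂ (∫ x, g x ∂(lam.colour i)) * ∫ y, f y ∂(lam.colour j) := by
  rw [Kernel.prod_apply, integral_prod_mul (fun x => starRingEnd ℂ (g x)) f, integral_conj]
  rfl

theorem integral_pairs (hr : 0 < r) (hX : ∀ᵐ lam ∂μ, lam ∈ uniformlyDiscrete d m r)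
    (i j : Fin m) (f g : 𝓢(Space d, ℂ)) :
    ∫ lam, starRingEnd ℂ (∫ x, g x ∂(lam.colour i)) * ∫ y, f y ∂(lam.colour j) ∂μ =
      ∫ z, ∫ a, starRingEnd ℂ (g a) * f (a + z) ∂volume ∂(pairMoment μ i j) := by
  have := isLocallyFiniteMeasure_pairMoment hr hX i j
  have hT : Measurable fun p : Space d × Space d => (p.1, p.2 - p.1) := by fun_prop
  have hint := integrable_pairMeasure hr hX i j f g
  let H : Space d × Space d → ℂ := fun q => starRingEnd ℂ (g q.1) * f (q.1 + q.2)
  have hHc : Continuous H :=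
    (RCLike.continuous_conj.comp (g.continuous.comp continuous_fst)).mul
      (f.continuous.comp (continuous_fst.add continuous_snd))
  have hHT : (fun p : Space d × Space d => H (p.1, p.2 - p.1)) =
      fun p => starRingEnd ℂ (g p.1) * f p.2 := by
    funext p; simp [H]
  have hHint : Integrable H (volume.prod (pairMoment μ i j)) := by
    rw [← map_pairMeasure hr hX i j,
      integrable_map_measure hHc.aestronglyMeasurable hT.aemeasurable]
    change Integrable (fun p : Space d × Space d => H (p.1, p.2 - p.1)) _
    rwa [hHT]
  calc _ = ∫ lam, ∫ p, starRingEnd ℂ (g p.1) * f p.2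
          ∂((colourKernel d m i ×ₖ colourKernel d m j) lam) ∂μ := by
        refine integral_congr_ae (ae_of_all _ fun lam => ?_)
        exact (integral_conj_mul_colour lam i j f g).symm
    _ = ∫ p, starRingEnd ℂ (g p.1) * f p.2 ∂(pairMeasure μ i j) :=
        (integral_bind_kernel hint).symm
    _ = ∫ q, H q ∂((pairMeasure μ i j).map (fun p => (p.1, p.2 - p.1))) := by
        rw [integral_map hT.aemeasurable hHc.aestronglyMeasurable, hHT]
    _ = _ := by
        rw [map_pairMeasure hr hX i j, integral_prod_symm _ hHint]

end Pairs

/-! ### Characters, modulation and Plancherel. -/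

section Character

variable {d : ℕ}

/-- The character `x ↦ exp(2πi k⬝x)`. -/
def character (k x : Space d) : ℂ := Complex.exp (2 * Real.pi * Complex.I * (inner ℝ k x : ℝ))

theorem norm_character (k x : Space d) : ‖character k x‖ = 1 := by
  rw [character, show (2 * Real.pi * Complex.I * (inner ℝ k x : ℝ) : ℂ) =
    ((2 * Real.pi * inner ℝ k x : ℝ) : ℂ) * Complex.I by push_cast; ring]
  exact Complex.norm_exp_ofReal_mul_I _

theorem character_comm (k x : Space d) : character k x = character x k := by
  rw [character, character, real_inner_comm]

theorem character_add (k x y : Space d) : character k (x + y) = character k x * character k y := by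
  simp only [character, inner_add_right, ← Complex.exp_add]
  congr 1; push_cast; ring

@[simp] theorem character_zero (k : Space d) : character k 0 = 1 := by simp [character]

theorem character_neg_mul (k x : Space d) : character k (-x) * character k x = 1 := by
  rw [← character_add, neg_add_cancel, character_zero]

theorem conj_character (k x : Space d) : starRingEnd ℂ (character k x) = character k (-x) := by
  rw [character, character, ← Complex.exp_conj]
  congr 1
  simp [Complex.conj_ofReal, Complex.conj_ofNat]

theorem continuous_character : Continuous (Function.uncurry (character : Space d → Space d → ℂ)) := by
  unfold character Function.uncurry
  fun_prop

theorem continuous_character_left (x : Space d) : Continuous fun k => character k x :=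
  continuous_character.comp (by fun_prop : Continuous fun k => (k, x))

theorem hasTemperateGrowth_cexp_I :
    (fun s : ℝ => Complex.exp (2 * Real.pi * Complex.I * s)).HasTemperateGrowth := by
  refine ⟨Complex.contDiff_exp.comp (contDiff_const.mul Complex.ofRealCLM.contDiff),
    fun n => ⟨0, ‖(2 * Real.pi * Complex.I : ℂ)‖ ^ n, fun s => ?_⟩⟩
  rw [norm_iteratedFDeriv_eq_norm_iteratedDeriv]
  have h : ∀ n : ℕ, iteratedDeriv n (fun s : ℝ => Complex.exp (2 * Real.pi * Complex.I * s)) =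
      fun s : ℝ => (2 * Real.pi * Complex.I) ^ n * Complex.exp (2 * Real.pi * Complex.I * s) := by
    intro n
    induction n with
    | zero => simp
    | succ n ih =>
      rw [iteratedDeriv_succ, ih]
      funext s
      have h1 : HasDerivAt (fun s : ℝ => (2 * Real.pi * Complex.I : ℂ) * s)
          (2 * Real.pi * Complex.I) s := by
        simpa using (Complex.ofRealCLM.hasDerivAt (x := s)).const_mul
          (2 * Real.pi * Complex.I : ℂ)
      rw [(h1.cexp.const_mul _).deriv]
      ring
  rw [h n, norm_mul, norm_pow, show (2 * Real.pi * Complex.I * (s : ℂ) : ℂ) =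
    ((2 * Real.pi * s : ℝ) : ℂ) * Complex.I by push_cast; ring, Complex.norm_exp_ofReal_mul_I]
  simp

theorem hasTemperateGrowth_character (t : Space d) :
    (fun x => character x t).HasTemperateGrowth :=
  hasTemperateGrowth_cexp_I.comp (Function.hasTemperateGrowth_inner_left t)

/-- Multiplication of a Schwartz function by the character `x ↦ exp(2πi x⬝t)`. -/
def modulate (t : Space d) (f : 𝓢(Space d, ℂ)) : 𝓢(Space d, ℂ) :=
  SchwartzMap.smulLeftCLM ℂ (fun x => character x t) f

@[simp] theorem modulate_apply (t : Space d) (f : 𝓢(Space d, ℂ)) (x : Space d) :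
    modulate t f x = character x t * f x :=
  SchwartzMap.smulLeftCLM_apply_apply (hasTemperateGrowth_character t) f x

theorem fourier_apply_eq (f : 𝓢(Space d, ℂ)) (a : Space d) :
    𝓕 f a = ∫ x, character x (-a) * f x := by
  rw [SchwartzMap.fourier_coe, Real.fourier_eq']
  refine integral_congr_ae (ae_of_all _ fun x => ?_)
  simp only [character, smul_eq_mul, inner_neg_right]
  congr 2; push_cast; ring

theorem fourier_modulate (t : Space d) (f : 𝓢(Space d, ℂ)) (a : Space d) :
    𝓕 (modulate t f) a = 𝓕 f (a - t) := by
  rw [fourier_apply_eq, fourier_apply_eq]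
  refine integral_congr_ae (ae_of_all _ fun x => ?_)
  beta_reduce
  rw [modulate_apply, ← mul_assoc, ← character_add]
  congr 2; abel

/-- Plancherel's formula for the correlation of two Fourier transforms. -/
theorem integral_conj_fourier_mul_fourier (f g h : 𝓢(Space d, ℂ))
    (hh : ∀ x, h x = starRingEnd ℂ (g x) * f x) (z : Space d) :
    ∫ a, starRingEnd ℂ (𝓕 g a) * 𝓕 f (a + z) = 𝓕 h z := by
  have h1 := SchwartzMap.integral_inner_fourier_fourier g (modulate (-z) f)
  simp only [RCLike.inner_apply', fourier_modulate, sub_neg_eq_add] at h1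
  rw [h1, fourier_apply_eq]
  refine integral_congr_ae (ae_of_all _ fun x => ?_)
  simp only [modulate_apply, hh]
  ring

end Character

/-! ### The first moment as a covariance. -/

section Isometry

variable {d m : ℕ} {r : ℝ} {μ : Measure (PointMeasure d m)} [IsProbabilityMeasure μ]
  {w : Fin m → ℝ}

theorem measurable_weightedCount (w : Fin m → ℝ) (f : 𝓢(Space d, ℂ)) :
    Measurable (weightedCount w f : PointMeasure d m → ℂ) := by
  refine Finset.measurable_sum _ fun j _ => Measurable.const_mul ?_ _
  have : StronglyMeasurable fun lam : PointMeasure d m => ∫ x, f x ∂(colourKernel d m j lam) :=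
    StronglyMeasurable.integral_kernel f.continuous.stronglyMeasurable
  exact this.measurable

/-- The bound sees `f` only through its decay majorant, so it is uniform over families with a common
majorant. -/
theorem exists_norm_weightedCount_le (m : ℕ) (hr : 0 < r) (w : Fin m → ℝ) :
    ∃ C : ℝ, 0 ≤ C ∧ ∀ lam ∈ uniformlyDiscrete d m r, ∀ (f : Space d → ℂ) (B : ℝ),
      0 ≤ B → (∀ x, ‖f x‖ ≤ B * decayWeight x) → ‖weightedCount w f lam‖ ≤ B * C := by
  obtain ⟨C, hC, h⟩ := exists_lintegral_colour_le (r := r) d m hr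
  refine ⟨∑ j, |w j| * C.toReal, by positivity, fun lam hlam f B hB hf => ?_⟩
  rw [weightedCount, Finset.mul_sum]
  refine norm_sum_le_of_le _ fun j _ => ?_
  have h1 : ‖∫ x, f x ∂(lam.colour j)‖ ≤ B * C.toReal := by
    have h2 := (enorm_integral_le_lintegral_enorm f).trans (h lam hlam j f B hB hf)
    have h3 := ENNReal.toReal_mono (ENNReal.mul_ne_top ENNReal.ofReal_ne_top hC) h2
    simpa [ENNReal.toReal_mul, hB] using h3
  rw [norm_mul, Complex.norm_real, Real.norm_eq_abs]
  nlinarith [abs_nonneg (w j), mul_le_mul_of_nonneg_left h1 (abs_nonneg (w j))]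

theorem weightedFirstMoment_eq_sum (hr : 0 < r) (hX : ∀ᵐ lam ∂μ, lam ∈ uniformlyDiscrete d m r)
    (w : Fin m → ℝ) (f : 𝓢(Space d, ℂ)) :
    weightedFirstMoment μ w f =
      ∑ i, ∑ j, (w i : ℂ) * ((w j : ℂ) * ∫ z, f z ∂(pairMoment μ i j)) := by
  rw [weightedFirstMoment, weightedPalmIntegral]
  refine Finset.sum_congr rfl fun i _ => ?_
  rw [← Finset.mul_sum]
  congr 1
  have hint (j : Fin m) : Integrable f ((palm μ i).bind (colourKernel d m j)) := by
    have := hasTemperateGrowth_pairMoment hr hX i j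
    exact f.integrable (μ := pairMoment μ i j)
  unfold weightedCount
  have hint' (j : Fin m) : Integrable (fun lam : PointMeasure d m => ∫ x, f x ∂(lam.colour j))
      (palm μ i) := integrable_integral_of_bind (hint j)
  rw [integral_finsetSum _ fun j _ => (hint' j).const_mul _]
  refine Finset.sum_congr rfl fun j _ => ?_
  rw [integral_const_mul, pairMoment, integral_bind_kernel (hint j)]
  rfl

variable [VAddInvariantMeasure (Space d) (PointMeasure d m) μ]

variable (μ) in
/-- The weighted first moment, composed with the Fourier transform of Schwartz functions. -/
def spectralFunctional (w : Fin m → ℝ) (f : 𝓢(Space d, ℂ)) : ℂ :=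
  weightedFirstMoment μ w (𝓕 f : 𝓢(Space d, ℂ))

/-- The weighted count of the Fourier transform of a Schwartz function. -/
def fourierCount (w : Fin m → ℝ) (f : 𝓢(Space d, ℂ)) : PointMeasure d m → ℂ :=
  weightedCount w (𝓕 f : 𝓢(Space d, ℂ))

/-- The weighted first moment of the Palm measure as a covariance. -/
theorem integral_conj_fourierCount_mul (hr : 0 < r)
    (hX : ∀ᵐ lam ∂μ, lam ∈ uniformlyDiscrete d m r) (w : Fin m → ℝ) (f g h : 𝓢(Space d, ℂ))
    (hh : ∀ x, h x = starRingEnd ℂ (g x) * f x) :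
    ∫ lam, starRingEnd ℂ (fourierCount w g lam) * fourierCount w f lam ∂μ =
      spectralFunctional μ w h := by
  have hint (i j : Fin m) : Integrable (fun lam : PointMeasure d m =>
      starRingEnd ℂ (∫ x, 𝓕 g x ∂(lam.colour i)) * ∫ y, 𝓕 f y ∂(lam.colour j)) μ := by
    have h := integrable_integral_of_bind (integrable_pairMeasure hr hX i j (𝓕 f) (𝓕 g))
    simpa only [integral_conj_mul_colour] using h
  rw [spectralFunctional, weightedFirstMoment_eq_sum hr hX]
  have hexp (lam : PointMeasure d m) :
      starRingEnd ℂ (fourierCount w g lam) * fourierCount w f lam =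
      ∑ i, ∑ j, (w i : ℂ) * ((w j : ℂ) *
        (starRingEnd ℂ (∫ x, 𝓕 g x ∂(lam.colour i)) * ∫ y, 𝓕 f y ∂(lam.colour j))) := by
    rw [fourierCount, fourierCount, weightedCount, weightedCount, map_sum, Finset.sum_mul_sum]
    refine Finset.sum_congr rfl fun i _ => Finset.sum_congr rfl fun j _ => ?_
    rw [map_mul, Complex.conj_ofReal]
    ring
  simp_rw [hexp]
  rw [integral_finsetSum _ fun i _ => integrable_finsetSum _ fun j _ =>
    ((hint i j).const_mul _).const_mul _]
  refine Finset.sum_congr rfl fun i _ => ?_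
  rw [integral_finsetSum _ fun j _ => ((hint i j).const_mul _).const_mul _]
  refine Finset.sum_congr rfl fun j _ => ?_
  rw [integral_const_mul, integral_const_mul, integral_pairs hr hX]
  simp_rw [integral_conj_fourier_mul_fourier f g h hh]

end Isometry

open scoped ContDiff

/-! ### Density of compactly supported Schwartz functions. -/

section SmoothDense

variable {d : ℕ}

/-- A smooth bump function, `1` on the unit ball, with compact support. -/
def unitBump (d : ℕ) : ContDiffBump (0 : Space d) := ⟨1, 2, one_pos, one_lt_two⟩

/-- The rescaled complex-valued bump functions `x ↦ χ (x / (n + 1))`. -/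
def scaledBump (d n : ℕ) (x : Space d) : ℂ := unitBump d (((n : ℝ) + 1)⁻¹ • x)

theorem contDiff_unitBump : ContDiff ℝ ∞ fun x : Space d => (unitBump d x : ℂ) :=
  Complex.ofRealCLM.contDiff.comp (unitBump d).contDiff

theorem hasCompactSupport_unitBump : HasCompactSupport fun x : Space d => (unitBump d x : ℂ) :=
  (unitBump d).hasCompactSupport.comp_left Complex.ofReal_zero

theorem contDiff_scaledBump (n : ℕ) : ContDiff ℝ ∞ (scaledBump d n) :=
  contDiff_unitBump.comp (contDiff_const_smul _)

theorem hasCompactSupport_scaledBump (n : ℕ) : HasCompactSupport (scaledBump d n) :=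
  hasCompactSupport_unitBump.comp_homeomorph
    (Homeomorph.smulOfNeZero ((n : ℝ) + 1)⁻¹ (by positivity))

theorem exists_norm_iteratedFDeriv_bump_le (d i : ℕ) : ∃ K : ℝ, 0 ≤ K ∧
    ∀ x : Space d, ‖iteratedFDeriv ℝ i (fun x : Space d => (unitBump d x : ℂ) - 1) x‖ ≤ K := by
  have hc : Continuous fun x : Space d => iteratedFDeriv ℝ i (fun x => (unitBump d x : ℂ)) x :=
    contDiff_unitBump.continuous_iteratedFDeriv (mod_cast le_top)
  obtain ⟨C, hC⟩ := (hasCompactSupport_unitBump (d := d)).iteratedFDeriv (𝕜 := ℝ) i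
    |>.exists_bound_of_continuous hc
  refine ⟨C + 1, by linarith [(norm_nonneg _).trans (hC 0)], fun x => ?_⟩
  rcases i with _ | i
  · rw [norm_iteratedFDeriv_zero]
    have := hC x
    rw [norm_iteratedFDeriv_zero] at this
    refine (norm_sub_le _ _).trans ?_
    simpa using this
  · have h : iteratedFDeriv ℝ (i + 1) (fun x : Space d => (unitBump d x : ℂ) - 1) x =
        iteratedFDeriv ℝ (i + 1) (fun x : Space d => (unitBump d x : ℂ)) x := by
      rw [show (fun x : Space d => (unitBump d x : ℂ) - 1) =
        (fun x => (unitBump d x : ℂ)) - fun _ => (1 : ℂ) from rfl,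
        iteratedFDeriv_sub_apply (contDiff_unitBump.contDiffAt.of_le (mod_cast le_top))
          contDiffAt_const, iteratedFDeriv_const_of_ne (by simp)]
      simp
    rw [h]
    linarith [hC x]

/-- Each derivative of positive order gains a factor `1 / (n + 1)`. At order zero the difference
vanishes for `‖x‖ ≤ n + 1`, and beyond that `‖x‖ / (n + 1)` exceeds `1`. The growth in `‖x‖` costs
one more power in the Schwartz seminorm. -/
theorem exists_norm_iteratedFDeriv_scaledBump_le (d i : ℕ) : ∃ K : ℝ, 0 ≤ K ∧
    ∀ (n : ℕ) (x : Space d), ‖iteratedFDeriv ℝ i (fun x : Space d => scaledBump d n x - 1) x‖ ≤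
      K * (1 + ‖x‖) * ((n : ℝ) + 1)⁻¹ := by
  obtain ⟨K, hK, h⟩ := exists_norm_iteratedFDeriv_bump_le d i
  refine ⟨K, hK, fun n x => ?_⟩
  set c : ℝ := ((n : ℝ) + 1)⁻¹ with hc
  have hc0 : 0 < c := by positivity
  have hc1 : c ≤ 1 := inv_le_one_of_one_le₀ (by linarith [n.cast_nonneg (α := ℝ)])
  have hs : ContDiff ℝ i (fun x : Space d => (unitBump d x : ℂ) - 1) :=
    (contDiff_unitBump.sub contDiff_const).of_le (mod_cast le_top)
  have h1 : iteratedFDeriv ℝ i (fun x : Space d => scaledBump d n x - 1) x =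
      c ^ i • iteratedFDeriv ℝ i (fun x : Space d => (unitBump d x : ℂ) - 1) (c • x) := by
    exact congrFun (iteratedFDeriv_comp_const_smul c hs) x
  rw [h1, norm_smul, Real.norm_of_nonneg (by positivity)]
  rcases i with _ | i
  · rw [pow_zero, one_mul]
    by_cases hx : ‖c • x‖ ≤ 1
    · have hz : (unitBump d (c • x) : ℂ) - 1 = 0 := by
        rw [(unitBump d).one_of_mem_closedBall (by simpa [unitBump] using hx)]
        simp
      rw [norm_iteratedFDeriv_zero, hz, norm_zero]
      positivity
    · refine (h _).trans ?_
      rw [norm_smul, Real.norm_of_nonneg hc0.le] at hx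
      nlinarith [norm_nonneg x]
  · have h2 : c ^ (i + 1) ≤ c := by
      rw [pow_succ]
      exact mul_le_of_le_one_left hc0.le (pow_le_one₀ hc0.le hc1)
    calc c ^ (i + 1) * ‖_‖ ≤ c * K := by gcongr; exact h _
      _ ≤ K * (1 + ‖x‖) * c := by nlinarith [norm_nonneg x, mul_nonneg hc0.le hK]

/-- Multiplication of a Schwartz function by the rescaled bump functions. -/
def truncate (n : ℕ) (f : 𝓢(Space d, ℂ)) : 𝓢(Space d, ℂ) :=
  SchwartzMap.smulLeftCLM ℂ (scaledBump d n) f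

theorem truncate_apply (n : ℕ) (f : 𝓢(Space d, ℂ)) (x : Space d) :
    truncate n f x = scaledBump d n x * f x :=
  SchwartzMap.smulLeftCLM_apply_apply
    ((hasCompactSupport_scaledBump n).hasTemperateGrowth (contDiff_scaledBump n)) f x

theorem hasCompactSupport_truncate (n : ℕ) (f : 𝓢(Space d, ℂ)) :
    HasCompactSupport (truncate n f) := by
  have h : (truncate n f : Space d → ℂ) = scaledBump d n * f := by
    funext x; exact truncate_apply n f x
  rw [h]
  exact (hasCompactSupport_scaledBump n).mul_right

theorem tendsto_truncate (f : 𝓢(Space d, ℂ)) : Tendsto (fun n => truncate n f) atTop (𝓝 f) := by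
  rw [(schwartz_withSeminorms ℝ (Space d) ℂ).tendsto_nhds]
  rintro ⟨k, l⟩ ε hε
  choose K hK hbd using exists_norm_iteratedFDeriv_scaledBump_le d
  set A : ℝ := ∑ i ∈ Finset.range (l + 1), (l.choose i : ℝ) * K i *
    (SchwartzMap.seminorm ℝ k (l - i) f + SchwartzMap.seminorm ℝ (k + 1) (l - i) f) with hA
  have hA0 : 0 ≤ A := Finset.sum_nonneg fun i _ => by have := hK i; positivity
  have hle (n : ℕ) : SchwartzMap.seminorm ℝ k l (truncate n f - f) ≤ A * ((n : ℝ) + 1)⁻¹ := by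
    refine SchwartzMap.seminorm_le_bound ℝ k l _ (by positivity) fun x => ?_
    have h1 : (truncate n f - f : 𝓢(Space d, ℂ)) =
        fun x => (scaledBump d n x - 1) * f x := by
      funext x
      simp [truncate_apply, sub_mul]
    rw [h1]
    have h2 := norm_iteratedFDeriv_mul_le (𝕜 := ℝ) (N := ∞) (n := l)
      ((contDiff_scaledBump (d := d) n).sub (contDiff_const (c := (1 : ℂ)))) (f.smooth ⊤) x
      (mod_cast le_top)
    calc _ ≤ ‖x‖ ^ k * ∑ i ∈ Finset.range (l + 1), (l.choose i : ℝ) *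
          (K i * (1 + ‖x‖) * ((n : ℝ) + 1)⁻¹) * ‖iteratedFDeriv ℝ (l - i) f x‖ := by
          gcongr
          refine h2.trans ?_
          gcongr with i hi
          exact hbd i n x
      _ = ∑ i ∈ Finset.range (l + 1), (l.choose i : ℝ) * K i *
          (‖x‖ ^ k * ‖iteratedFDeriv ℝ (l - i) f x‖ +
            ‖x‖ ^ (k + 1) * ‖iteratedFDeriv ℝ (l - i) f x‖) * ((n : ℝ) + 1)⁻¹ := by
          rw [Finset.mul_sum]
          refine Finset.sum_congr rfl fun i _ => ?_
          ring
      _ ≤ A * ((n : ℝ) + 1)⁻¹ := by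
          rw [hA, Finset.sum_mul]
          gcongr with i hi
          · exact mul_nonneg (Nat.cast_nonneg _) (hK i)
          · exact SchwartzMap.le_seminorm ℝ k (l - i) f x
          · exact SchwartzMap.le_seminorm ℝ (k + 1) (l - i) f x
  have hlim : Tendsto (fun n : ℕ => A * ((n : ℝ) + 1)⁻¹) atTop (𝓝 0) := by
    simpa [one_div] using tendsto_one_div_add_atTop_nhds_zero_nat.const_mul A
  filter_upwards [hlim.eventually (gt_mem_nhds hε)] with n hn
  exact (hle n).trans_lt hn

/-- Continuous functionals on Schwartz functions are determined by the functions with compact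
support. -/
theorem schwartz_functional_ext {Λ₁ Λ₂ : 𝓢(Space d, ℂ) →L[ℂ] ℂ}
    (h : ∀ f : 𝓢(Space d, ℂ), HasCompactSupport f → Λ₁ f = Λ₂ f) : Λ₁ = Λ₂ := by
  ext f
  have h1 := (Λ₁.continuous.tendsto f).comp (tendsto_truncate f)
  have h2 := (Λ₂.continuous.tendsto f).comp (tendsto_truncate f)
  refine tendsto_nhds_unique h1 (h2.congr fun n => ?_)
  exact (h _ (hasCompactSupport_truncate n f)).symm

end SmoothDense

/-! ### A Bochner–Schwartz theorem. -/

section PositiveFunctional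

variable {d : ℕ}

/-- The smooth functions among the continuous functions with compact support. -/
def smoothCompact (d : ℕ) : Submodule ℝ C_c(Space d, ℝ) where
  carrier := {f | ContDiff ℝ ∞ (fun x => f x)}
  add_mem' {f g} hf hg := by
    change ContDiff ℝ ∞ fun x => f x + g x
    exact ContDiff.add hf hg
  zero_mem' := by
    change ContDiff ℝ ∞ fun _ : Space d => (0 : ℝ)
    exact contDiff_const
  smul_mem' c f hf := by
    change ContDiff ℝ ∞ fun x => c * f x
    exact contDiff_const.mul hf

/-- A smooth real function with compact support as a complex Schwartz function. -/
def smoothCompactToSchwartz (d : ℕ) : smoothCompact d →ₗ[ℝ] 𝓢(Space d, ℂ) where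
  toFun f := HasCompactSupport.toSchwartzMap (f := fun x => ((f : C_c(Space d, ℝ)) x : ℂ))
    ((f : C_c(Space d, ℝ)).hasCompactSupport.comp_left Complex.ofReal_zero)
    (Complex.ofRealCLM.contDiff.comp f.2)
  map_add' f g := by
    ext x
    exact Complex.ofReal_add ((f : C_c(Space d, ℝ)) x) ((g : C_c(Space d, ℝ)) x)
  map_smul' c f := by
    ext x
    exact Complex.ofReal_mul c ((f : C_c(Space d, ℝ)) x)

/-- A smooth function with compact support in the sense of `smoothCompact`. -/
def smoothCompact.mk (f : Space d → ℝ) (hf : ContDiff ℝ ∞ f) (hc : HasCompactSupport f) :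
    smoothCompact d := ⟨⟨⟨f, hf.continuous⟩, hc⟩, hf⟩

theorem exists_smoothCompact_eq_one {K : Set (Space d)} (hK : IsCompact K) :
    ∃ χ : smoothCompact d, (∀ x ∈ K, (χ : C_c(Space d, ℝ)) x = 1) ∧
      ∀ x, 0 ≤ (χ : C_c(Space d, ℝ)) x := by
  obtain ⟨R, hR⟩ := hK.isBounded.subset_closedBall (0 : Space d)
  let b : ContDiffBump (0 : Space d) := ⟨max R 1, max R 1 + 1, by positivity, by linarith⟩
  refine ⟨smoothCompact.mk b b.contDiff b.hasCompactSupport, fun x hx => ?_, fun x => b.nonneg⟩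
  exact b.one_of_mem_closedBall (Metric.closedBall_subset_closedBall (le_max_left _ _) (hR hx))

/-- A functional on Schwartz functions is positive definite if it is nonnegative on the functions
of the form `|g|²`. -/
def IsPositiveOnSquares (Λ : 𝓢(Space d, ℂ) →L[ℂ] ℂ) : Prop :=
  ∀ g h : 𝓢(Space d, ℂ), (∀ x, h x = starRingEnd ℂ (g x) * g x) → 0 ≤ (Λ h).re ∧ (Λ h).im = 0

/-- Nonnegative smooth functions with compact support are limits of squares. -/
theorem IsPositiveOnSquares.nonneg {Λ : 𝓢(Space d, ℂ) →L[ℂ] ℂ} (hΛ : IsPositiveOnSquares Λ)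
    (f : smoothCompact d) (hf : ∀ x, 0 ≤ (f : C_c(Space d, ℝ)) x) :
    0 ≤ (Λ (smoothCompactToSchwartz d f)).re ∧ (Λ (smoothCompactToSchwartz d f)).im = 0 := by
  obtain ⟨χ, hχ1, hχ0⟩ := exists_smoothCompact_eq_one
    (f : C_c(Space d, ℝ)).hasCompactSupport.isCompact
  have hfc : ContDiff ℝ ∞ fun x => (f : C_c(Space d, ℝ)) x := f.2
  have hχc : ContDiff ℝ ∞ fun x => (χ : C_c(Space d, ℝ)) x := χ.2
  set F : Space d → ℝ := fun x => (f : C_c(Space d, ℝ)) x with hF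
  set X : Space d → ℝ := fun x => (χ : C_c(Space d, ℝ)) x with hX
  have hXs : HasCompactSupport X := (χ : C_c(Space d, ℝ)).hasCompactSupport
  let χ2 : smoothCompact d := smoothCompact.mk (fun x => X x * X x) (hχc.mul hχc) hXs.mul_right
  have hχ2 := hΛ (smoothCompactToSchwartz d χ) (smoothCompactToSchwartz d χ2) fun x => by
    change ((X x * X x : ℝ) : ℂ) = starRingEnd ℂ (X x : ℂ) * (X x : ℂ)
    simp
  -- The root of `f` need not be smooth, but that of `f + ε` is. As `χ = 1` on the support of `f`,
  -- one has `f + ε χ² = (χ √(f + ε))²`, and then `ε → 0`.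
  have key (ε : ℝ) (hε : 0 < ε) :
      0 ≤ (Λ (smoothCompactToSchwartz d (f + ε • χ2))).re ∧
        (Λ (smoothCompactToSchwartz d (f + ε • χ2))).im = 0 := by
    have hpos (x) : F x + ε ≠ 0 := by have := hf x; positivity
    let g : smoothCompact d := smoothCompact.mk (fun x => X x * √(F x + ε))
      (hχc.mul ((hfc.add contDiff_const).sqrt hpos)) hXs.mul_right
    refine hΛ (smoothCompactToSchwartz d g) _ fun x => ?_
    change ((F x + ε * (X x * X x) : ℝ) : ℂ) =
      starRingEnd ℂ ((X x * √(F x + ε) : ℝ) : ℂ) * ((X x * √(F x + ε) : ℝ) : ℂ)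
    rw [Complex.conj_ofReal, ← Complex.ofReal_mul]
    congr 1
    rw [mul_mul_mul_comm, Real.mul_self_sqrt (by have := hf x; positivity)]
    by_cases hx : x ∈ tsupport F
    · rw [show X x = 1 from hχ1 x hx]; ring
    · rw [image_eq_zero_of_notMem_tsupport hx]; ring
  have hadd (ε : ℝ) : Λ (smoothCompactToSchwartz d (f + ε • χ2)) =
      Λ (smoothCompactToSchwartz d f) + (ε : ℂ) * Λ (smoothCompactToSchwartz d χ2) := by
    rw [map_add, map_add, map_smul]
    congr 1
    have : (ε • smoothCompactToSchwartz d χ2 : 𝓢(Space d, ℂ)) =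
        (ε : ℂ) • smoothCompactToSchwartz d χ2 := by
      ext x; simp
    rw [this, map_smul, smul_eq_mul]
  constructor
  · refine le_of_forall_pos_le_add fun δ hδ => ?_
    set c := (Λ (smoothCompactToSchwartz d χ2)).re
    have hc : 0 ≤ c := hχ2.1
    have h := (key (δ / (c + 1)) (by positivity)).1
    rw [hadd, Complex.add_re, Complex.re_ofReal_mul] at h
    have : δ / (c + 1) * c ≤ δ := by
      rw [div_mul_eq_mul_div, div_le_iff₀ (by positivity)]
      nlinarith
    linarith
  · have h := (key 1 one_pos).2
    rw [hadd, Complex.add_im, Complex.im_ofReal_mul, hχ2.2] at h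
    linarith

theorem exists_bound_compactlySupported (f : C_c(Space d, ℝ)) : ∃ M : ℝ, 0 ≤ M ∧ ∀ x, |f x| ≤ M := by
  obtain ⟨M, hM⟩ := f.hasCompactSupport.exists_bound_of_continuous f.continuous
  exact ⟨M, (norm_nonneg _).trans (hM 0), hM⟩

/-- The domination hypothesis of the Riesz extension theorem. It also writes a smooth `f` as a
difference of nonnegative smooth functions. -/
theorem exists_smoothCompact_add_nonneg (f : C_c(Space d, ℝ)) :
    ∃ φ : smoothCompact d, (∀ x, 0 ≤ (φ : C_c(Space d, ℝ)) x) ∧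
      ∀ x, 0 ≤ (φ : C_c(Space d, ℝ)) x + f x := by
  obtain ⟨χ, hχ1, hχ0⟩ := exists_smoothCompact_eq_one f.hasCompactSupport.isCompact
  obtain ⟨M, hM0, hM⟩ := exists_bound_compactlySupported f
  refine ⟨M • χ, fun x => mul_nonneg hM0 (hχ0 x), fun x => ?_⟩
  change 0 ≤ M * (χ : C_c(Space d, ℝ)) x + f x
  by_cases hx : x ∈ tsupport f
  · rw [hχ1 x hx]
    linarith [neg_abs_le (f x), hM x]
  · rw [image_eq_zero_of_notMem_tsupport hx, add_zero]
    exact mul_nonneg hM0 (hχ0 x)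

/-- The cone of nonnegative continuous functions with compact support. -/
def nonnegCone (d : ℕ) : PointedCone ℝ C_c(Space d, ℝ) where
  carrier := {f | ∀ x, 0 ≤ f x}
  add_mem' hf hg x := add_nonneg (hf x) (hg x)
  zero_mem' _ := le_rfl
  smul_mem' c _ hf x := mul_nonneg c.2 (hf x)

/-- A positive functional is given by a locally finite measure on smooth functions with compact
support. -/
theorem IsPositiveOnSquares.exists_measure {Λ : 𝓢(Space d, ℂ) →L[ℂ] ℂ}
    (hΛ : IsPositiveOnSquares Λ) : ∃ ν : Measure (Space d), IsLocallyFiniteMeasure ν ∧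
      ∀ f : smoothCompact d, Λ (smoothCompactToSchwartz d f) =
        ((∫ x, (f : C_c(Space d, ℝ)) x ∂ν : ℝ) : ℂ) := by
  let F : C_c(Space d, ℝ) →ₗ.[ℝ] ℝ :=
    ⟨smoothCompact d, Complex.reLm.comp
      ((Λ.toLinearMap.restrictScalars ℝ).comp (smoothCompactToSchwartz d))⟩
  obtain ⟨G, hGF, hG⟩ := riesz_extension (nonnegCone d) F
    (fun f hf => (hΛ.nonneg f hf).1) (fun f => by
      obtain ⟨φ, -, hφ⟩ := exists_smoothCompact_add_nonneg f
      exact ⟨φ, hφ⟩)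
  let P : C_c(Space d, ℝ) →ₚ[ℝ] ℝ := PositiveLinearMap.mk₀ G hG
  refine ⟨RealRMK.rieszMeasure P, inferInstance, fun f => ?_⟩
  have h1 : ∫ x, (f : C_c(Space d, ℝ)) x ∂(RealRMK.rieszMeasure P) =
      (Λ (smoothCompactToSchwartz d f)).re :=
    (RealRMK.integral_rieszMeasure P f).trans (hGF f)
  have h2 : (Λ (smoothCompactToSchwartz d f)).im = 0 := by
    obtain ⟨φ, hφ0, hφ⟩ := exists_smoothCompact_add_nonneg (f : C_c(Space d, ℝ))
    have ha := (hΛ.nonneg φ hφ0).2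
    have hb := (hΛ.nonneg (φ + f) hφ).2
    rw [map_add, map_add, Complex.add_im, ha, zero_add] at hb
    exact hb
  rw [h1]
  exact Complex.ext (by simp) (by simpa using h2)

/-- Translates of Schwartz functions. -/
def translate (k : Space d) (g : 𝓢(Space d, ℂ)) : 𝓢(Space d, ℂ) :=
  SchwartzMap.compSubConstCLM ℂ k g

@[simp] theorem translate_apply (k : Space d) (g : 𝓢(Space d, ℂ)) (x : Space d) :
    translate k g x = g (x - k) := rfl

/-- A version of the Bochner–Schwartz theorem: a continuous functional on Schwartz functions which
is nonnegative on squares, with a bound on translates of squares, is a measure. -/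
theorem IsPositiveOnSquares.exists_measure_schwartz {Λ : 𝓢(Space d, ℂ) →L[ℂ] ℂ}
    (hΛ : IsPositiveOnSquares Λ)
    (hb : ∀ g : 𝓢(Space d, ℂ), ∃ C : ℝ, ∀ (k : Space d) (h : 𝓢(Space d, ℂ)),
      (∀ x, h x = starRingEnd ℂ (translate k g x) * translate k g x) → ‖Λ h‖ ≤ C) :
    ∃ ν : Measure (Space d), IsLocallyFiniteMeasure ν ∧ ν.HasTemperateGrowth ∧
      ∀ f : 𝓢(Space d, ℂ), ∫ x, f x ∂ν = Λ f := by
  obtain ⟨ν, hν, hΛν⟩ := hΛ.exists_measure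
  -- The square of a translated bump is `1` on the translated unit ball, so the bound on translates
  -- of a square bounds all unit balls. This yields temperate growth and makes integration against
  -- `ν` continuous on Schwartz functions.
  have hball : ∃ K : ℝ≥0∞, K ≠ ⊤ ∧ ∀ a, ν (Metric.ball a 1) ≤ K := by
    let b := unitBump d
    let g : smoothCompact d := smoothCompact.mk b b.contDiff b.hasCompactSupport
    obtain ⟨C, hC⟩ := hb (smoothCompactToSchwartz d g)
    refine ⟨ENNReal.ofReal C, ENNReal.ofReal_ne_top, fun a => ?_⟩
    have hs : ContDiff ℝ ∞ fun x => b (x - a) := b.contDiff.comp (contDiff_id.sub contDiff_const)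
    have hsc : HasCompactSupport fun x => b (x - a) :=
      b.hasCompactSupport.comp_homeomorph (Homeomorph.subRight a)
    let h : smoothCompact d := smoothCompact.mk (fun x => b (x - a) * b (x - a))
      (hs.mul hs) hsc.mul_right
    have h1 := hC a (smoothCompactToSchwartz d h) fun x => by
      change ((b (x - a) * b (x - a) : ℝ) : ℂ) =
        starRingEnd ℂ (b (x - a) : ℂ) * (b (x - a) : ℂ)
      simp
    rw [hΛν, Complex.norm_real] at h1
    have hint : Integrable (fun x => b (x - a) * b (x - a)) ν :=
      (h : C_c(Space d, ℝ)).continuous.integrable_of_hasCompactSupport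
        (h : C_c(Space d, ℝ)).hasCompactSupport
    calc ν (Metric.ball a 1) = ∫⁻ x in Metric.ball a 1, 1 ∂ν := by simp
      _ ≤ ∫⁻ x in Metric.ball a 1, ENNReal.ofReal (b (x - a) * b (x - a)) ∂ν := by
          refine setLIntegral_mono' measurableSet_ball fun x hx => ?_
          rw [b.one_of_mem_closedBall]
          · simp
          · simpa [b, unitBump, dist_eq_norm] using (Metric.mem_ball.1 hx).le
      _ ≤ ∫⁻ x, ENNReal.ofReal (b (x - a) * b (x - a)) ∂ν := setLIntegral_le_lintegral _ _
      _ = ENNReal.ofReal (∫ x, b (x - a) * b (x - a) ∂ν) :=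
          (ofReal_integral_eq_lintegral_ofReal hint
            (ae_of_all _ fun x => mul_self_nonneg _)).symm
      _ ≤ ENNReal.ofReal C := ENNReal.ofReal_le_ofReal ((le_abs_self _).trans h1)
  obtain ⟨K, hK, hball⟩ := hball
  have htg : ν.HasTemperateGrowth := hasTemperateGrowth_of_ball_le one_pos hK hball
  refine ⟨ν, hν, htg, fun f => ?_⟩
  have heq : SchwartzMap.integralCLM ℂ ν = Λ := by
    refine schwartz_functional_ext fun f hf => ?_
    let u : smoothCompact d := smoothCompact.mk (fun x => (f x).re)
      (Complex.reCLM.contDiff.comp (f.smooth ⊤)) (hf.comp_left Complex.zero_re)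
    let v : smoothCompact d := smoothCompact.mk (fun x => (f x).im)
      (Complex.imCLM.contDiff.comp (f.smooth ⊤)) (hf.comp_left Complex.zero_im)
    have hfuv : f = smoothCompactToSchwartz d u + Complex.I • smoothCompactToSchwartz d v := by
      ext x
      change f x = ((f x).re : ℂ) + Complex.I * ((f x).im : ℂ)
      rw [mul_comm, Complex.re_add_im]
    have hreal (u : smoothCompact d) : SchwartzMap.integralCLM ℂ ν (smoothCompactToSchwartz d u) =
        Λ (smoothCompactToSchwartz d u) := by
      rw [hΛν, SchwartzMap.integralCLM_apply]
      exact integral_ofReal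
    rw [hfuv, map_add, map_add, map_smul, map_smul, hreal, hreal]
  rw [← heq, SchwartzMap.integralCLM_apply]

end PositiveFunctional

/-! ### Existence and uniqueness of the diffraction. -/

section Diffraction

variable {d m : ℕ} {r : ℝ} {μ : Measure (PointMeasure d m)} {w : Fin m → ℝ}
  {ν ν₁ ν₂ : Measure (Space d)}

/-- Locally finite measures with the same integrals of Schwartz functions are equal. -/
theorem measure_ext_of_schwartz [IsLocallyFiniteMeasure ν₁] [IsLocallyFiniteMeasure ν₂]
    (h : ∀ f : 𝓢(Space d, ℂ), ∫ x, f x ∂ν₁ = ∫ x, f x ∂ν₂) : ν₁ = ν₂ := by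
  refine Measure.ext_of_integral_eq_on_compactlySupported fun f => ?_
  have : IsFiniteMeasureOnCompacts (ν₁ + ν₂) :=
    ⟨fun K hK => by
      rw [Measure.add_apply]
      exact ENNReal.add_lt_top.2 ⟨hK.measure_lt_top, hK.measure_lt_top⟩⟩
  refine eq_of_abs_sub_le_all fun ε hε => ?_
  -- Approximation in `L¹` of the sum gives one smooth `g` that is close to `f` for both measures.
  obtain ⟨g, hgc, hgs, hg⟩ := HasCompactSupport.exist_eLpNorm_sub_le_of_continuous (ν₁ + ν₂)
    (p := 1) (ε := ε / 2) (by positivity) f.hasCompactSupport f.continuous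
  have hfi (ν : Measure (Space d)) [IsLocallyFiniteMeasure ν] : Integrable f ν :=
    f.continuous.integrable_of_hasCompactSupport f.hasCompactSupport
  have hgi (ν : Measure (Space d)) [IsLocallyFiniteMeasure ν] : Integrable g ν :=
    hgs.continuous.integrable_of_hasCompactSupport hgc
  have hclose (ν : Measure (Space d)) [IsLocallyFiniteMeasure ν] (hν : ν ≤ ν₁ + ν₂) :
      |∫ x, f x ∂ν - ∫ x, g x ∂ν| ≤ ε / 2 := by
    rw [← integral_sub (hfi ν) (hgi ν), ← Real.norm_eq_abs]
    have h1 := (enorm_integral_le_lintegral_enorm (μ := ν) fun x => f x - g x).trans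
      ((lintegral_mono' hν le_rfl).trans (by simpa [eLpNorm_one_eq_lintegral_enorm] using hg))
    simpa [ENNReal.toReal_ofReal (by positivity : 0 ≤ ε / 2)] using
      ENNReal.toReal_mono ENNReal.ofReal_ne_top h1
  have hg12 : ∫ x, g x ∂ν₁ = ∫ x, g x ∂ν₂ := by
    have h1 : ∫ x, (g x : ℂ) ∂ν₁ = ∫ x, (g x : ℂ) ∂ν₂ := h (HasCompactSupport.toSchwartzMap (f := fun x => (g x : ℂ))
      (hgc.comp_left Complex.ofReal_zero) (Complex.ofRealCLM.contDiff.comp hgs))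
    simp only [integral_complex_ofReal] at h1
    exact_mod_cast h1
  have h1 := hclose ν₁ (Measure.le_add_right le_rfl)
  have h2 := hclose ν₂ (Measure.le_add_left le_rfl)
  rw [hg12] at h1
  rw [abs_le] at *
  constructor <;> linarith [h1.1, h1.2, h2.1, h2.2]

theorem IsDiffraction.unique (h₁ : IsDiffraction μ w ν₁) (h₂ : IsDiffraction μ w ν₂) :
    ν₁ = ν₂ := by
  have := h₁.locallyFinite
  have := h₂.locallyFinite
  exact measure_ext_of_schwartz fun f => (h₁.integral_eq f).trans (h₂.integral_eq f).symm

theorem fourier_translate (k : Space d) (g : 𝓢(Space d, ℂ)) (a : Space d) :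
    𝓕 (translate k g) a = character k (-a) * 𝓕 g a := by
  rw [fourier_apply_eq, fourier_apply_eq, ← integral_const_mul]
  rw [← integral_add_right_eq_self _ k]
  refine integral_congr_ae (ae_of_all _ fun x => ?_)
  simp only [translate_apply, add_sub_cancel_right]
  rw [character_comm, character_add, character_comm k, character_comm x]
  ring

variable [IsProbabilityMeasure μ]

theorem exists_spectralCLM (hr : 0 < r) (hX : ∀ᵐ lam ∂μ, lam ∈ uniformlyDiscrete d m r)
    (w : Fin m → ℝ) : ∃ Λ : 𝓢(Space d, ℂ) →L[ℂ] ℂ, ∀ f, Λ f = spectralFunctional μ w f := by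
  have := hasTemperateGrowth_pairMoment hr hX
  refine ⟨∑ i, ∑ j, ((w i : ℂ) * (w j : ℂ)) • (SchwartzMap.integralCLM ℂ (pairMoment μ i j) ∘L
    FourierTransform.fourierCLM ℂ 𝓢(Space d, ℂ)), fun f => ?_⟩
  rw [spectralFunctional, weightedFirstMoment_eq_sum hr hX]
  simp only [sum_apply, smul_apply,
    ContinuousLinearMap.comp_apply, FourierTransform.fourierCLM_apply,
    SchwartzMap.integralCLM_apply, smul_eq_mul, mul_assoc]

/-- Translating `g` multiplies its Fourier transform by a unimodular character. A bound that depends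
only on `|𝓕 g|` therefore holds for all translates. -/
theorem exists_norm_fourierCount_le (hr : 0 < r) (w : Fin m → ℝ) (g : 𝓢(Space d, ℂ)) :
    ∃ C : ℝ, ∀ lam ∈ uniformlyDiscrete d m r, ∀ f : 𝓢(Space d, ℂ),
      (∀ a, ‖𝓕 f a‖ = ‖𝓕 g a‖) → ‖fourierCount w f lam‖ ≤ C := by
  obtain ⟨C, -, h⟩ := exists_norm_weightedCount_le (d := d) m hr w
  obtain ⟨B, hB, hg⟩ := exists_norm_le_decayWeight (𝓕 g)
  exact ⟨B * C, fun lam hlam f hf => h lam hlam _ B hB fun x => (hf x).trans_le (hg x)⟩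

variable [VAddInvariantMeasure (Space d) (PointMeasure d m) μ]

/-- On a square `|g|²` the functional equals the mean of `|N^w_ĝ|²`, so it is nonnegative. The
counts are almost surely bounded uniformly over the translates of `g`, which is the second
hypothesis of the Bochner–Schwartz theorem. -/
theorem exists_isDiffraction (hr : 0 < r) (hX : ∀ᵐ lam ∂μ, lam ∈ uniformlyDiscrete d m r)
    (w : Fin m → ℝ) :
    ∃ ν : Measure (Space d), IsDiffraction μ w ν ∧ ν.HasTemperateGrowth := by
  obtain ⟨Λ, hΛ⟩ := exists_spectralCLM hr hX w
  have hpos : IsPositiveOnSquares Λ := fun g h hh => by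
    rw [hΛ, ← integral_conj_fourierCount_mul hr hX w g g h hh]
    have h1 (lam : PointMeasure d m) : starRingEnd ℂ (fourierCount w g lam) *
        fourierCount w g lam = ((‖fourierCount w g lam‖ ^ 2 : ℝ) : ℂ) := by
      rw [Complex.conj_mul', Complex.ofReal_pow]
    simp only [h1, integral_complex_ofReal, Complex.ofReal_re, Complex.ofReal_im, and_true]
    positivity
  obtain ⟨ν, hν, htg, hint⟩ := hpos.exists_measure_schwartz fun g => by
    obtain ⟨C, hC⟩ := exists_norm_fourierCount_le (m := m) hr w g
    refine ⟨C * C, fun k h hh => ?_⟩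
    rw [hΛ, ← integral_conj_fourierCount_mul hr hX w _ _ h hh]
    have h1 := norm_integral_le_of_norm_le_const (μ := μ) (C := C * C)
      (f := fun lam => starRingEnd ℂ (fourierCount w (translate k g) lam) *
        fourierCount w (translate k g) lam) (by
          filter_upwards [hX] with lam hlam
          have h2 := hC lam hlam (translate k g) fun a => by
            rw [fourier_translate, norm_mul, norm_character, one_mul]
          rw [norm_mul, RCLike.norm_conj]
          exact mul_le_mul h2 h2 (norm_nonneg _) ((norm_nonneg _).trans h2))
    simpa using h1
  refine ⟨ν, ⟨hν, fun f => f.integrable, fun f => ?_⟩, htg⟩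
  rw [hint, hΛ, spectralFunctional, SchwartzMap.fourier_coe]

theorem IsDiffraction.hasTemperateGrowth (hr : 0 < r)
    (hX : ∀ᵐ lam ∂μ, lam ∈ uniformlyDiscrete d m r) (hν : IsDiffraction μ w ν) :
    ν.HasTemperateGrowth := by
  obtain ⟨ν', h', ht⟩ := exists_isDiffraction hr hX w
  rwa [hν.unique h']

theorem existsUnique_isDiffraction (hr : 0 < r)
    (hX : ∀ᵐ lam ∂μ, lam ∈ uniformlyDiscrete d m r) (w : Fin m → ℝ) :
    ∃! ν : Measure (Space d), IsDiffraction μ w ν := by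
  obtain ⟨ν, hν, -⟩ := exists_isDiffraction hr hX w
  exact ⟨ν, hν, fun ν' hν' => hν'.unique hν⟩

/-- The correlation of weighted counts in terms of the diffraction measure. -/
theorem IsDiffraction.integral_conj_mul (hr : 0 < r)
    (hX : ∀ᵐ lam ∂μ, lam ∈ uniformlyDiscrete d m r) (hν : IsDiffraction μ w ν)
    (f g : 𝓢(Space d, ℂ)) :
    ∫ lam, starRingEnd ℂ (fourierCount w g lam) * fourierCount w f lam ∂μ =
      ∫ k, starRingEnd ℂ (g k) * f k ∂ν := by
  let h : 𝓢(Space d, ℂ) := SchwartzMap.pairing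
    ((ContinuousLinearMap.mul ℝ ℂ).comp (Complex.conjCLE : ℂ →L[ℝ] ℂ)) g f
  rw [integral_conj_fourierCount_mul hr hX w f g h fun x => rfl, spectralFunctional,
    SchwartzMap.fourier_coe, ← hν.integral_eq]
  rfl

end Diffraction

/-! ### Multiplication operators and translations on `L²`. -/

section MulBounded

variable {α : Type*} [MeasurableSpace α] {μ : Measure α} {φ : α → ℂ} {C : ℝ}

theorem memLp_mul_of_bound (hφ : AEStronglyMeasurable φ μ) (hC : ∀ᵐ x ∂μ, ‖φ x‖ ≤ C)
    {u : α → ℂ} (hu : MemLp u 2 μ) : MemLp (fun x => φ x * u x) 2 μ := by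
  refine hu.of_le_mul (hφ.mul hu.1) (c := C) ?_
  filter_upwards [hC] with x hx
  rw [norm_mul]
  gcongr

/-- Multiplication by a bounded function as an operator on `L²`. -/
def mulBounded (hφ : AEStronglyMeasurable φ μ) (hC : ∀ᵐ x ∂μ, ‖φ x‖ ≤ C) :
    Lp ℂ 2 μ →L[ℂ] Lp ℂ 2 μ :=
  LinearMap.mkContinuous
    { toFun u := (memLp_mul_of_bound hφ hC (Lp.memLp u)).toLp _
      map_add' u v := by
        rw [← MemLp.toLp_add, MemLp.toLp_eq_toLp_iff]
        filter_upwards [Lp.coeFn_add u v] with x hx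
        simp only [hx, Pi.add_apply, mul_add]
      map_smul' c u := by
        rw [RingHom.id_apply, ← MemLp.toLp_const_smul, MemLp.toLp_eq_toLp_iff]
        filter_upwards [Lp.coeFn_smul c u] with x hx
        simp only [hx, Pi.smul_apply, smul_eq_mul, mul_left_comm] }
    C fun u => by
      refine Lp.norm_le_mul_norm_of_ae_le_mul ?_
      filter_upwards [hC, (memLp_mul_of_bound hφ hC (Lp.memLp u)).coeFn_toLp] with x hx h
      simp only [LinearMap.coe_mk, AddHom.coe_mk]
      rw [h, norm_mul]
      gcongr

theorem coeFn_mulBounded (hφ : AEStronglyMeasurable φ μ) (hC : ∀ᵐ x ∂μ, ‖φ x‖ ≤ C)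
    (u : Lp ℂ 2 μ) : mulBounded hφ hC u =ᵐ[μ] fun x => φ x * u x :=
  (memLp_mul_of_bound hφ hC (Lp.memLp u)).coeFn_toLp

end MulBounded

section Koopman

variable {d m : ℕ} (μ : Measure (PointMeasure d m))
  [VAddInvariantMeasure (Space d) (PointMeasure d m) μ]

/-- The action of translations on `L²`. -/
def koopman (t : Space d) : Lp ℂ 2 μ →ₗᵢ[ℂ] Lp ℂ 2 μ :=
  Lp.compMeasurePreservingₗᵢ ℂ (fun lam => -t +ᵥ lam) (measurePreserving_vadd (-t) μ)

theorem coeFn_koopman (t : Space d) (f : Lp ℂ 2 μ) :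
    koopman μ t f =ᵐ[μ] fun lam => f (-t +ᵥ lam) :=
  Lp.coeFn_compMeasurePreserving f (measurePreserving_vadd (-t) μ)

variable {μ}

theorem isEigenfunction_iff {f : Lp ℂ 2 μ} : IsEigenfunction μ f ↔
    f ≠ 0 ∧ ∃ k : Space d, ∀ t : Space d, koopman μ t f = character k t • f := by
  refine and_congr_right fun _ => exists_congr fun k => forall_congr' fun t => ?_
  rw [Lp.ext_iff]
  constructor
  · intro h
    exact (coeFn_koopman μ t f).trans (h.trans (Lp.coeFn_smul (character k t) f).symm)
  · intro h
    exact (coeFn_koopman μ t f).symm.trans (h.trans (Lp.coeFn_smul (character k t) f))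

end Koopman

/-! ### The diffraction isometry. -/

section Spectral

variable {d m : ℕ} {r : ℝ} {μ : Measure (PointMeasure d m)} [IsProbabilityMeasure μ]
  {w : Fin m → ℝ} {ν : Measure (Space d)}

/-- The source of the intertwining relation: modulation of `f` translates `𝓕 f`, which amounts to
translating the configuration the opposite way. -/
theorem fourierCount_modulate (w : Fin m → ℝ) (t : Space d) (f : 𝓢(Space d, ℂ))
    (lam : PointMeasure d m) :
    fourierCount w (modulate t f) lam = fourierCount w f (-t +ᵥ lam) := by
  unfold fourierCount weightedCount
  refine Finset.sum_congr rfl fun j _ => ?_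
  rw [PointMeasure.colour_vadd, show (fun x : Space d => -t + x) = MeasurableEquiv.addLeft (-t)
    from rfl, (MeasurableEquiv.addLeft (-t)).measurableEmbedding.integral_map]
  congr 1
  refine integral_congr_ae (ae_of_all _ fun x => ?_)
  simp only [fourier_modulate, MeasurableEquiv.coe_addLeft]
  congr 1
  abel

theorem memLp_fourierCount (hr : 0 < r) (hX : ∀ᵐ lam ∂μ, lam ∈ uniformlyDiscrete d m r)
    (w : Fin m → ℝ) (f : 𝓢(Space d, ℂ)) : MemLp (fourierCount w f) 2 μ := by
  obtain ⟨C, hC⟩ := exists_norm_fourierCount_le (m := m) hr w f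
  refine MemLp.of_bound (measurable_weightedCount w _).aestronglyMeasurable C ?_
  filter_upwards [hX] with lam hlam
  exact hC lam hlam f fun _ => rfl

/-- The weighted counts of Fourier transforms as elements of `L²`. -/
def fourierCountLp (hr : 0 < r) (hX : ∀ᵐ lam ∂μ, lam ∈ uniformlyDiscrete d m r)
    (w : Fin m → ℝ) : 𝓢(Space d, ℂ) →ₗ[ℂ] Lp ℂ 2 μ where
  toFun f := (memLp_fourierCount hr hX w f).toLp _
  map_add' f g := by
    rw [← MemLp.toLp_add, MemLp.toLp_eq_toLp_iff]
    filter_upwards [hX] with lam hlam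
    simp only [fourierCount, weightedCount, Pi.add_apply]
    rw [← Finset.sum_add_distrib]
    refine Finset.sum_congr rfl fun j _ => ?_
    rw [← mul_add, ← integral_add (integrable_colour hr hlam j _)
      (integrable_colour hr hlam j _), FourierTransform.fourier_add]
    rfl
  map_smul' c f := by
    rw [RingHom.id_apply, ← MemLp.toLp_const_smul, MemLp.toLp_eq_toLp_iff]
    refine ae_of_all _ fun lam => ?_
    simp only [fourierCount, weightedCount, Pi.smul_apply, smul_eq_mul]
    rw [Finset.mul_sum]
    refine Finset.sum_congr rfl fun j _ => ?_
    rw [mul_left_comm, FourierTransform.fourier_smul]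
    congr 1
    exact integral_const_mul c _

theorem coeFn_fourierCountLp (hr : 0 < r) (hX : ∀ᵐ lam ∂μ, lam ∈ uniformlyDiscrete d m r)
    (w : Fin m → ℝ) (f : 𝓢(Space d, ℂ)) :
    fourierCountLp hr hX w f =ᵐ[μ] fourierCount w f :=
  (memLp_fourierCount hr hX w f).coeFn_toLp

theorem norm_character_le (t : Space d) : ∀ᵐ k ∂ν, ‖character k t‖ ≤ 1 :=
  ae_of_all _ fun k => (norm_character k t).le

variable (ν) in
/-- Multiplication by the character `k ↦ exp(2πi k⬝t)` on `L²`. -/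
def mulCharacter (t : Space d) : Lp ℂ 2 ν →L[ℂ] Lp ℂ 2 ν :=
  mulBounded (φ := fun k => character k t)
    (continuous_character_left t).measurable.aestronglyMeasurable (norm_character_le t)

theorem coeFn_mulCharacter (t : Space d) (u : Lp ℂ 2 ν) :
    mulCharacter ν t u =ᵐ[ν] fun k => character k t * u k :=
  coeFn_mulBounded _ _ u

variable [VAddInvariantMeasure (Space d) (PointMeasure d m) μ] [ν.HasTemperateGrowth]

theorem IsDiffraction.norm_fourierCountLp (hr : 0 < r)
    (hX : ∀ᵐ lam ∂μ, lam ∈ uniformlyDiscrete d m r) (hν : IsDiffraction μ w ν)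
    (f : 𝓢(Space d, ℂ)) : ‖fourierCountLp hr hX w f‖ = ‖f.toLp 2 ν‖ := by
  have h : inner ℂ (fourierCountLp hr hX w f) (fourierCountLp hr hX w f) =
      inner ℂ (f.toLp 2 ν) (f.toLp 2 ν) := by
    rw [SchwartzMap.inner_toL2_toL2_eq f f ν, L2.inner_def]
    simp only [RCLike.inner_apply']
    rw [← hν.integral_conj_mul hr hX]
    refine integral_congr_ae ?_
    filter_upwards [coeFn_fourierCountLp hr hX w f] with lam h
    rw [h]
  rw [inner_self_eq_norm_sq_to_K, inner_self_eq_norm_sq_to_K] at h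
  have h' : ‖fourierCountLp hr hX w f‖ ^ 2 = ‖f.toLp 2 ν‖ ^ 2 := by exact_mod_cast h
  exact (sq_eq_sq₀ (norm_nonneg _) (norm_nonneg _)).1 h'

/-- The diffraction isometry. -/
theorem IsDiffraction.exists_isometry (hr : 0 < r)
    (hX : ∀ᵐ lam ∂μ, lam ∈ uniformlyDiscrete d m r) (hν : IsDiffraction μ w ν) :
    ∃ θ : Lp ℂ 2 ν →ₗᵢ[ℂ] Lp ℂ 2 μ, (∀ f, θ (f.toLp 2 ν) = fourierCountLp hr hX w f) ∧
      ∀ t u, koopman μ t (θ u) = θ (mulCharacter ν t u) := by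
  have := hν.locallyFinite
  let e : 𝓢(Space d, ℂ) →ₗ[ℂ] Lp ℂ 2 ν := (SchwartzMap.toLpCLM ℂ ℂ 2 ν).toLinearMap
  have hdense : DenseRange e := SchwartzMap.denseRange_toLpCLM (F := ℂ) (by simp)
  have hnorm (f : 𝓢(Space d, ℂ)) : ‖fourierCountLp hr hX w f‖ ≤ 1 * ‖e f‖ := by
    rw [one_mul]
    exact (hν.norm_fourierCountLp hr hX f).le
  let T := (fourierCountLp hr hX w).extendOfNorm e
  have hT (f : 𝓢(Space d, ℂ)) : T (e f) = fourierCountLp hr hX w f :=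
    LinearMap.extendOfNorm_eq hdense ⟨1, hnorm⟩ f
  refine ⟨⟨T.toLinearMap, fun u => ?_⟩, hT, fun t u => ?_⟩
  · refine hdense.induction_on (p := fun u => ‖T u‖ = ‖u‖) u
      (isClosed_eq (by fun_prop) (by fun_prop)) fun f => ?_
    rw [hT]
    exact hν.norm_fourierCountLp hr hX f
  · change koopman μ t (T u) = T (mulCharacter ν t u)
    refine hdense.induction_on (p := fun u => koopman μ t (T u) = T (mulCharacter ν t u)) u
      (isClosed_eq (by fun_prop) (by fun_prop)) fun f => ?_
    have h1 : mulCharacter ν t (e f) = e (modulate t f) := by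
      refine Lp.ext ?_
      filter_upwards [coeFn_mulCharacter t (e f), f.coeFn_toLp 2 ν,
        (modulate t f).coeFn_toLp 2 ν] with k h1 h2 h3
      rw [h1]
      change character k t * f.toLp 2 ν k = (modulate t f).toLp 2 ν k
      rw [h2, h3, modulate_apply]
    rw [h1, hT, hT]
    refine Lp.ext ?_
    filter_upwards [coeFn_koopman μ t (fourierCountLp hr hX w f),
      coeFn_fourierCountLp hr hX w (modulate t f),
      (measurePreserving_vadd (-t) μ).quasiMeasurePreserving.ae
        (coeFn_fourierCountLp hr hX w f)] with lam h1 h2 h3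
    rw [h1, h2, h3, fourierCount_modulate]

end Spectral

/-! ### Joint eigenvectors of multiplication by characters. -/

section MulCharacter

variable {d : ℕ} {ν : Measure (Space d)}

theorem eq_of_character_eq {k k₀ : Space d} (h : ∀ t, character k t = character k₀ t) :
    k = k₀ := by
  by_contra hne
  have hv : ‖k - k₀‖ ^ 2 ≠ 0 := by simpa [sub_eq_zero] using hne
  -- At this `t` the phases differ by half a period, so the two characters have opposite signs.
  have h1 := h ((1 / (2 * ‖k - k₀‖ ^ 2)) • (k - k₀))
  set t := (1 / (2 * ‖k - k₀‖ ^ 2)) • (k - k₀) with ht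
  have h2 : inner ℝ k t = inner ℝ k₀ t + 1 / 2 := by
    rw [← sub_eq_iff_eq_add', ← inner_sub_left, ht, inner_smul_right, real_inner_self_eq_norm_sq,
      div_mul_eq_mul_div, one_mul, mul_comm, ← div_div, div_self hv]
  have h3 : character k t = -character k₀ t := by
    rw [character, h2, character, show (2 * Real.pi * Complex.I * ((inner ℝ k₀ t + 1 / 2 : ℝ) : ℂ)) =
      2 * Real.pi * Complex.I * (inner ℝ k₀ t : ℝ) + Real.pi * Complex.I by push_cast; ring,
      Complex.exp_add, Complex.exp_pi_mul_I, mul_neg_one]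
  have h4 : character k₀ t = 0 := by
    rw [h3] at h1
    exact self_eq_neg.1 h1.symm
  have h5 := norm_character k₀ t
  rw [h4, norm_zero] at h5
  exact zero_ne_one h5

theorem inner_mulCharacter_mulCharacter (t : Space d) (u v : Lp ℂ 2 ν) :
    inner ℂ (mulCharacter ν t u) (mulCharacter ν t v) = inner ℂ u v := by
  rw [L2.inner_def, L2.inner_def]
  refine integral_congr_ae ?_
  filter_upwards [coeFn_mulCharacter t u, coeFn_mulCharacter t v] with k hu hv
  rw [hu, hv, RCLike.inner_apply', RCLike.inner_apply', map_mul, conj_character]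
  linear_combination (starRingEnd ℂ (u k) * v k) * character_neg_mul k t

theorem mulCharacter_mulCharacter_neg (t : Space d) (u : Lp ℂ 2 ν) :
    mulCharacter ν t (mulCharacter ν (-t) u) = u := by
  refine Lp.ext ?_
  filter_upwards [coeFn_mulCharacter t (mulCharacter ν (-t) u), coeFn_mulCharacter (-t) u]
    with k h1 h2
  rw [h1, h2]
  linear_combination u k * character_neg_mul k t

/-- Joint eigenvectors of the multiplications by characters are concentrated in a point. -/
theorem ae_eq_of_mulCharacter_eq {k₀ : Space d} {u : Lp ℂ 2 ν}
    (hu : ∀ t, mulCharacter ν t u = character k₀ t • u) : ∀ᵐ k ∂ν, u k ≠ 0 → k = k₀ := by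
  -- The exceptional null set depends on `t`. A countable dense set of `t` gives a common one, and
  -- continuity in `t` does the rest.
  have h (n : ℕ) : ∀ᵐ k ∂ν, character k (TopologicalSpace.denseSeq (Space d) n) * u k =
      character k₀ (TopologicalSpace.denseSeq (Space d) n) * u k := by
    have h2 := hu (TopologicalSpace.denseSeq (Space d) n)
    rw [Lp.ext_iff] at h2
    filter_upwards [coeFn_mulCharacter (TopologicalSpace.denseSeq (Space d) n) u, h2,
      Lp.coeFn_smul (character k₀ (TopologicalSpace.denseSeq (Space d) n)) u] with k h1 h2 h3
    rw [← h1, h2, h3]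
    rfl
  filter_upwards [ae_all_iff.2 h] with k hk hk0
  refine eq_of_character_eq fun t => ?_
  have hc (k : Space d) : Continuous (character k) :=
    continuous_character.comp (by fun_prop : Continuous fun t => (k, t))
  exact congrFun ((TopologicalSpace.denseRange_denseSeq (Space d)).equalizer (hc k) (hc k₀)
    (funext fun n => mul_right_cancel₀ hk0 (hk n))) t

end MulCharacter

/-! ### Pure point diffraction and eigenfunctions. -/

section PurePoint

variable {d m : ℕ} {μ : Measure (PointMeasure d m)}

variable (μ) in
/-- The closed span of the eigenfunctions. -/
def eigenSpan : Submodule ℂ (Lp ℂ 2 μ) :=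
  (Submodule.span ℂ {f : Lp ℂ 2 μ | IsEigenfunction μ f}).topologicalClosure

theorem isClosed_eigenSpan : IsClosed (eigenSpan μ : Set (Lp ℂ 2 μ)) :=
  Submodule.isClosed_topologicalClosure _

theorem IsEigenfunction.mem_eigenSpan {f : Lp ℂ 2 μ} (hf : IsEigenfunction μ f) :
    f ∈ eigenSpan μ :=
  Submodule.le_topologicalClosure _ (Submodule.subset_span hf)

variable [VAddInvariantMeasure (Space d) (PointMeasure d m) μ] {ν : Measure (Space d)}

/-- There are only countably many atoms, so the diffuse part lives on their complement. Local
finiteness reduces its vanishing to sets of finite measure, whose indicators lie in `L²`. -/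
theorem isPurePoint_of_null [IsLocallyFiniteMeasure ν]
    (h : ∀ B : Set (Space d), MeasurableSet B → ν B ≠ ⊤ → (∀ k ∈ B, ν {k} = 0) → ν B = 0) :
    IsPurePoint ν := by
  have hS : {k | 0 < ν {k}}.Countable :=
    Measure.countable_meas_pos_of_disjoint_iUnion₀ (fun k => (measurableSet_singleton k).nullMeasurableSet)
      fun k l hkl => (disjoint_singleton.2 hkl).aedisjoint
  refine ⟨{k | 0 < ν {k}}, hS, measure_null_of_locally_null _ fun x _ => ?_⟩
  obtain ⟨U, hxU, hU, hνU⟩ := ν.exists_isOpen_measure_lt_top x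
  refine ⟨{k | 0 < ν {k}}ᶜ ∩ U, inter_mem_nhdsWithin _ (hU.mem_nhds hxU), ?_⟩
  refine h _ (hS.measurableSet.compl.inter hU.measurableSet)
    (measure_ne_top_of_subset inter_subset_right hνU.ne) fun k hk => ?_
  simpa using hk.1

/-- If the eigenfunctions span a dense subspace, a measure whose multiplication operators embed
isometrically is pure point. -/
theorem isPurePoint_of_isometry [IsLocallyFiniteMeasure ν] (θ : Lp ℂ 2 ν →ₗᵢ[ℂ] Lp ℂ 2 μ)
    (hθ : ∀ t u, koopman μ t (θ u) = θ (mulCharacter ν t u)) (h : HasPurePointSpectrum μ) :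
    IsPurePoint ν := by
  refine isPurePoint_of_null fun B hB hfin hB0 => ?_
  set F : Lp ℂ 2 ν := indicatorConstLp 2 hB hfin 1 with hF
  have horth : ∀ e ∈ {f : Lp ℂ 2 μ | IsEigenfunction μ f}, inner ℂ (θ F) e = 0 := by
    intro e he
    obtain ⟨-, k₀, hk₀⟩ := isEigenfunction_iff.1 he
    set u := ContinuousLinearMap.adjoint θ.toContinuousLinearMap e with hu
    have hadj (v : Lp ℂ 2 ν) : inner ℂ v u = inner ℂ (θ v) e :=
      ContinuousLinearMap.adjoint_inner_right θ.toContinuousLinearMap v e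
    -- Multiplication by a character is unitary, so the adjoint of `θ` intertwines as well and
    -- carries an eigenfunction to a joint eigenvector, possibly zero.
    have hchar (t : Space d) : mulCharacter ν t u = character k₀ t • u := by
      refine ext_inner_left ℂ fun v => ?_
      rw [← mulCharacter_mulCharacter_neg t v, inner_mulCharacter_mulCharacter, inner_smul_right]
      generalize mulCharacter ν (-t) v = v'
      rw [hadj, hadj, ← hθ, ← inner_smul_right, ← hk₀, LinearIsometry.inner_map_map]
    rw [← hadj, hF, L2.inner_indicatorConstLp_one hB hfin u]
    have h1 : ∀ᵐ k ∂ν, k ∈ B → k ≠ k₀ := by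
      by_cases hk : k₀ ∈ B
      · have : ∀ᵐ k ∂ν, k ≠ k₀ := by
          rw [ae_iff]
          simpa using hB0 k₀ hk
        filter_upwards [this] with k hk _ using hk
      · exact ae_of_all _ fun k hkB hkk => hk (hkk ▸ hkB)
    have h2 : ∀ᵐ k ∂ν, k ∈ B → u k = 0 := by
      filter_upwards [h1, ae_eq_of_mulCharacter_eq hchar] with k h1 h2 hkB
      by_contra h3
      exact h1 hkB (h2 h3)
    rw [setIntegral_congr_ae hB h2, integral_zero]
  have hzero : θ F = 0 := by
    refine Dense.eq_zero_of_inner_left ℂ h fun v hv => ?_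
    induction hv using Submodule.span_induction with
    | mem e he => exact horth e he
    | zero => exact inner_zero_right _
    | add a b _ _ ha hb => rw [inner_add_right, ha, hb, add_zero]
    | smul c a _ ha => rw [inner_smul_right, ha, mul_zero]
  have hF0 : F = 0 := θ.injective (hzero.trans (map_zero θ).symm)
  have h3 : inner ℂ F F = (ν.real B : ℂ) := by
    rw [hF, L2.inner_indicatorConstLp_one_indicatorConstLp_one hB hB hfin hfin, inter_self]
    rfl
  rw [hF0, inner_zero_left] at h3
  have h4 : ν.real B = 0 := by exact_mod_cast h3.symm
  exact (measureReal_eq_zero_iff hfin).1 h4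

theorem mem_eigenSpan_of_koopman {f : Lp ℂ 2 μ} {k : Space d}
    (h : ∀ t, koopman μ t f = character k t • f) : f ∈ eigenSpan μ := by
  by_cases hf : f = 0
  · rw [hf]; exact zero_mem _
  · exact (isEigenfunction_iff.2 ⟨hf, k, h⟩).mem_eigenSpan

/-- The indicator of a point `k` is multiplied by the constant `character k t`, so `θ` sends it to
an eigenfunction or to zero. A vector orthogonal to all these indicators vanishes at every atom,
hence almost everywhere for pure point `ν`. -/
theorem isometry_mem_eigenSpan [IsLocallyFiniteMeasure ν] (θ : Lp ℂ 2 ν →ₗᵢ[ℂ] Lp ℂ 2 μ)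
    (hθ : ∀ t u, koopman μ t (θ u) = θ (mulCharacter ν t u)) (h : IsPurePoint ν)
    (u : Lp ℂ 2 ν) : θ u ∈ eigenSpan μ := by
  let W : Submodule ℂ (Lp ℂ 2 ν) := (eigenSpan μ).comap θ.toLinearMap
  have hWc : IsClosed (W : Set (Lp ℂ 2 ν)) := isClosed_eigenSpan.preimage θ.continuous
  have : CompleteSpace W := hWc.completeSpace_coe
  obtain ⟨S, hS, hS0⟩ := h
  have hfin (k : Space d) : ν {k} ≠ ⊤ := isCompact_singleton.measure_ne_top
  have hmem (k : Space d) : indicatorConstLp 2 (measurableSet_singleton k) (hfin k) (1 : ℂ) ∈ W := by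
    refine mem_eigenSpan_of_koopman (k := k) fun t => ?_
    change koopman μ t (θ _) = character k t • θ _
    rw [hθ, ← map_smul]
    congr 1
    refine Lp.ext ?_
    filter_upwards [coeFn_mulCharacter t
      (indicatorConstLp 2 (measurableSet_singleton k) (hfin k) (1 : ℂ)), Lp.coeFn_smul
      (character k t) (indicatorConstLp 2 (measurableSet_singleton k) (hfin k) (1 : ℂ)),
      indicatorConstLp_coeFn (p := 2) (hs := measurableSet_singleton k) (hμs := hfin k)
        (c := (1 : ℂ))] with l h1 h2 h3
    rw [h1, h2, Pi.smul_apply, h3, smul_eq_mul]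
    by_cases hl : l = k
    · rw [hl]
    · rw [indicator_of_notMem (by simpa using hl), mul_zero, mul_zero]
  have hW : W = ⊤ := by
    rw [← Submodule.orthogonal_eq_bot_iff, Submodule.eq_bot_iff]
    intro G hG
    have h0 (k : Space d) : ν {k} = 0 ∨ G k = 0 := by
      have h1 := hG _ (hmem k)
      rw [L2.inner_indicatorConstLp_one (measurableSet_singleton k) (hfin k) G,
        integral_singleton] at h1
      rcases smul_eq_zero.1 h1 with h | h
      · exact Or.inl ((measureReal_eq_zero_iff (hfin k)).1 h)
      · exact Or.inr h
    rw [Lp.eq_zero_iff_ae_eq_zero]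
    have h1 : ∀ᵐ k ∂ν, k ∈ S := hS0
    -- The countable carrier may contain points of mass zero; together they form a null set.
    have h2 : ∀ᵐ k ∂ν, k ∈ S → ν {k} ≠ 0 := by
      have : ν {k ∈ S | ν {k} = 0} = 0 := by
        rw [← biUnion_of_singleton {k ∈ S | ν {k} = 0},
          measure_biUnion_null_iff (hS.mono fun k hk => hk.1)]
        exact fun k hk => hk.2
      rw [ae_iff]
      simpa using this
    filter_upwards [h1, h2] with k h1 h2
    exact (h0 k).resolve_left (h2 h1)
  change u ∈ W
  rw [hW]
  trivial

end PurePoint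

/-! ### Products in the closed span of the eigenfunctions. -/

section EigenAlgebra

variable {d m : ℕ} {μ : Measure (PointMeasure d m)}

theorem mem_eigenSpan_of_forall {T : Lp ℂ 2 μ →L[ℂ] Lp ℂ 2 μ}
    (hT : ∀ f, IsEigenfunction μ f → T f ∈ eigenSpan μ) {F : Lp ℂ 2 μ} (hF : F ∈ eigenSpan μ) :
    T F ∈ eigenSpan μ := by
  have h : eigenSpan μ ≤ (eigenSpan μ).comap T.toLinearMap :=
    Submodule.topologicalClosure_minimal _ (Submodule.span_le.2 hT)
      (isClosed_eigenSpan.preimage T.continuous)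
  exact h hF

variable [ErgodicVAdd (Space d) (PointMeasure d m) μ]

/-- Eigenfunctions have constant modulus. -/
theorem IsEigenfunction.exists_norm_eq {e : Lp ℂ 2 μ} (he : IsEigenfunction μ e) :
    ∃ C : ℝ, ∀ᵐ lam ∂μ, ‖e lam‖ = C := by
  obtain ⟨-, k, hk⟩ := he
  have hmeas : Measurable fun lam => ‖e lam‖ := (Lp.stronglyMeasurable e).measurable.norm
  refine exists_eventuallyEq_const_of_forall_separating MeasurableSet fun U hU => ?_
  -- The modulus is invariant under each translation almost everywhere, so ergodicity makes each of
  -- its level events null or conull.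
  have h := aeconst_of_forall_preimage_vadd_ae_eq (μ := μ) (Space d)
    (hmeas hU).nullMeasurableSet fun t => by
      refine Filter.Eventually.set_eq ?_
      filter_upwards [hk (-t)] with lam hlam
      have h1 : ‖e (t +ᵥ lam)‖ = ‖e lam‖ := by
        rw [neg_neg] at hlam
        rw [hlam, norm_mul]
        exact (congrArg (· * _) (norm_character k (-t))).trans (one_mul _)
      simp only [mem_preimage, h1]
  rcases eventuallyConst_set.1 h with h | h
  · exact Or.inl h
  · exact Or.inr h

/-- Two passages to the limit. Multiplication by the bounded `φ` is continuous, so `F` may be taken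
to be an eigenfunction `f`. As `f` has constant modulus, multiplication by `f` is continuous too, so
`G` may be taken to be an eigenfunction. A product of two eigenfunctions transforms under the sum of
their frequencies. -/
theorem mulBounded_mem_eigenSpan {φ : PointMeasure d m → ℂ} {C : ℝ} {G F : Lp ℂ 2 μ}
    (hφ : AEStronglyMeasurable φ μ) (hC : ∀ᵐ lam ∂μ, ‖φ lam‖ ≤ C) (hG : G ∈ eigenSpan μ)
    (hGφ : G =ᵐ[μ] φ) (hF : F ∈ eigenSpan μ) : mulBounded hφ hC F ∈ eigenSpan μ := by
  refine mem_eigenSpan_of_forall (fun f hf => ?_) hF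
  obtain ⟨D, hD⟩ := hf.exists_norm_eq
  have hD' : ∀ᵐ lam ∂μ, ‖f lam‖ ≤ D := hD.mono fun _ h => h.le
  have h1 : mulBounded hφ hC f = mulBounded (Lp.aestronglyMeasurable f) hD' G := by
    refine Lp.ext ?_
    filter_upwards [coeFn_mulBounded hφ hC f,
      coeFn_mulBounded (Lp.aestronglyMeasurable f) hD' G, hGφ] with lam h1 h2 h3
    rw [h1, h2, h3, mul_comm]
  rw [h1]
  refine mem_eigenSpan_of_forall (fun e he => ?_) hG
  obtain ⟨-, k, hk⟩ := isEigenfunction_iff.1 hf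
  obtain ⟨-, l, hl⟩ := isEigenfunction_iff.1 he
  refine mem_eigenSpan_of_koopman (k := k + l) fun t => Lp.ext ?_
  have hprod := coeFn_mulBounded (Lp.aestronglyMeasurable f) hD' e
  have hf1 := hk t
  have he1 := hl t
  rw [Lp.ext_iff] at hf1 he1
  filter_upwards [hf1, he1, coeFn_koopman μ t f, coeFn_koopman μ t e, hprod,
    Lp.coeFn_smul (character k t) f, Lp.coeFn_smul (character l t) e,
    coeFn_koopman μ t (mulBounded (Lp.aestronglyMeasurable f) hD' e),
    Lp.coeFn_smul (character (k + l) t) (mulBounded (Lp.aestronglyMeasurable f) hD' e),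
    (measurePreserving_vadd (-t) μ).quasiMeasurePreserving.ae hprod]
    with lam hf1 he1 hf2 he2 h1 h3 h4 h5 h6 h7
  rw [h5, h6, h7, ← hf2, ← he2, hf1, he1, h3, h4, Pi.smul_apply, Pi.smul_apply, Pi.smul_apply,
    h1, character_comm (k + l), character_add, character_comm t, character_comm t]
  simp only [smul_eq_mul]
  ring

end EigenAlgebra

/-! ### The algebra and σ-algebra of almost periodic functions and sets. -/

section AlmostPeriodic

variable {d m : ℕ} {μ : Measure (PointMeasure d m)}

/-- The essentially bounded functions in the closed span of the eigenfunctions. -/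
structure IsAlmostPeriodic (μ : Measure (PointMeasure d m)) (f : PointMeasure d m → ℂ) : Prop where
  bounded : ∃ C : ℝ, ∀ᵐ lam ∂μ, ‖f lam‖ ≤ C
  mem : ∃ F ∈ eigenSpan μ, F =ᵐ[μ] f

namespace IsAlmostPeriodic

variable {f g : PointMeasure d m → ℂ}

theorem aestronglyMeasurable (hf : IsAlmostPeriodic μ f) : AEStronglyMeasurable f μ := by
  obtain ⟨F, -, hF⟩ := hf.mem
  exact (Lp.aestronglyMeasurable F).congr hF

theorem congr (hf : IsAlmostPeriodic μ f) (h : f =ᵐ[μ] g) : IsAlmostPeriodic μ g := by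
  obtain ⟨C, hC⟩ := hf.bounded
  obtain ⟨F, hFE, hF⟩ := hf.mem
  refine ⟨⟨C, ?_⟩, F, hFE, hF.trans h⟩
  filter_upwards [hC, h] with lam h1 h2
  rwa [← h2]

theorem add (hf : IsAlmostPeriodic μ f) (hg : IsAlmostPeriodic μ g) :
    IsAlmostPeriodic μ fun lam => f lam + g lam := by
  obtain ⟨C, hC⟩ := hf.bounded
  obtain ⟨D, hD⟩ := hg.bounded
  obtain ⟨F, hFE, hF⟩ := hf.mem
  obtain ⟨G, hGE, hG⟩ := hg.mem
  refine ⟨⟨C + D, ?_⟩, F + G, add_mem hFE hGE, ?_⟩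
  · filter_upwards [hC, hD] with lam h1 h2
    exact (norm_add_le _ _).trans (add_le_add h1 h2)
  · filter_upwards [Lp.coeFn_add F G, hF, hG] with lam h1 h2 h3
    rw [h1, Pi.add_apply, h2, h3]

theorem const_mul (c : ℂ) (hf : IsAlmostPeriodic μ f) :
    IsAlmostPeriodic μ fun lam => c * f lam := by
  obtain ⟨C, hC⟩ := hf.bounded
  obtain ⟨F, hFE, hF⟩ := hf.mem
  refine ⟨⟨‖c‖ * C, ?_⟩, c • F, Submodule.smul_mem _ _ hFE, ?_⟩
  · filter_upwards [hC] with lam h1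
    rw [norm_mul]
    gcongr
  · filter_upwards [Lp.coeFn_smul c F, hF] with lam h1 h2
    rw [h1, Pi.smul_apply, h2, smul_eq_mul]

theorem mul [ErgodicVAdd (Space d) (PointMeasure d m) μ] (hf : IsAlmostPeriodic μ f) (hg : IsAlmostPeriodic μ g) :
    IsAlmostPeriodic μ fun lam => f lam * g lam := by
  obtain ⟨C, hC⟩ := hf.bounded
  obtain ⟨D, hD⟩ := hg.bounded
  obtain ⟨F, hFE, hF⟩ := hf.mem
  obtain ⟨G, hGE, hG⟩ := hg.mem
  refine ⟨⟨C * D, ?_⟩, mulBounded hf.aestronglyMeasurable hC G,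
    mulBounded_mem_eigenSpan _ _ hFE hF hGE, ?_⟩
  · filter_upwards [hC, hD] with lam h1 h2
    rw [norm_mul]
    exact mul_le_mul h1 h2 (norm_nonneg _) ((norm_nonneg _).trans h1)
  · filter_upwards [coeFn_mulBounded hf.aestronglyMeasurable hC G, hG] with lam h1 h2
    rw [h1, h2]

variable [IsProbabilityMeasure μ]

/-- Almost periodicity is stable under bounded limits. -/
theorem of_tendsto {f : ℕ → PointMeasure d m → ℂ} {C : ℝ}
    (hf : ∀ n, IsAlmostPeriodic μ (f n)) (hC : ∀ n, ∀ᵐ lam ∂μ, ‖f n lam‖ ≤ C)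
    (hlim : ∀ᵐ lam ∂μ, Tendsto (fun n => f n lam) atTop (𝓝 (g lam))) :
    IsAlmostPeriodic μ g := by
  have hgC : ∀ᵐ lam ∂μ, ‖g lam‖ ≤ C := by
    filter_upwards [ae_all_iff.2 hC, hlim] with lam h1 h2
    exact le_of_tendsto h2.norm (Eventually.of_forall h1)
  have hgm : AEStronglyMeasurable g μ :=
    aestronglyMeasurable_of_tendsto_ae atTop (fun n => (hf n).aestronglyMeasurable) hlim
  have hgL : MemLp g 2 μ := MemLp.of_bound hgm C hgC
  refine ⟨⟨C, hgC⟩, hgL.toLp g, ?_, hgL.coeFn_toLp⟩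
  have : CompleteSpace (eigenSpan μ) := (isClosed_eigenSpan (μ := μ)).completeSpace_coe
  -- For a closed subspace it suffices to test against its orthogonal complement, and dominated
  -- convergence passes the vanishing inner products to the limit.
  rw [← (eigenSpan μ).orthogonal_orthogonal]
  intro G hG
  have hz (n : ℕ) : ∫ lam, inner ℂ (G lam) (f n lam) ∂μ = 0 := by
    obtain ⟨F, hFE, hF⟩ := (hf n).mem
    have h1 := (Submodule.mem_orthogonal' _ _).1 hG F hFE
    rw [L2.inner_def] at h1
    rw [← h1]
    refine integral_congr_ae ?_
    filter_upwards [hF] with lam h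
    rw [h]
  have hGi : Integrable G μ := (Lp.memLp G).integrable (by norm_num)
  have h2 : Tendsto (fun n => ∫ lam, inner ℂ (G lam) (f n lam) ∂μ) atTop
      (𝓝 (∫ lam, inner ℂ (G lam) (g lam) ∂μ)) := by
    refine tendsto_integral_of_dominated_convergence (fun lam => ‖G lam‖ * C)
      (fun n => (Lp.aestronglyMeasurable G).inner (hf n).aestronglyMeasurable)
      (hGi.norm.mul_const C) (fun n => ?_) ?_
    · filter_upwards [hC n] with lam h
      exact (norm_inner_le_norm _ _).trans (by gcongr)
    · filter_upwards [hlim] with lam h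
      exact tendsto_const_nhds.inner h
  simp only [hz] at h2
  rw [L2.inner_def]
  refine Eq.trans (integral_congr_ae ?_) (tendsto_nhds_unique h2 tendsto_const_nhds)
  filter_upwards [hgL.coeFn_toLp] with lam h
  rw [h]

variable [ErgodicVAdd (Space d) (PointMeasure d m) μ]

theorem const (c : ℂ) : IsAlmostPeriodic μ fun _ => c := by
  refine ⟨⟨‖c‖, ae_of_all _ fun _ => le_rfl⟩, (memLp_const c).toLp _,
    mem_eigenSpan_of_koopman (k := 0) fun t => Lp.ext ?_, (memLp_const c).coeFn_toLp⟩
  have h := (memLp_const (μ := μ) (p := 2) c).coeFn_toLp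
  filter_upwards [h, coeFn_koopman μ t ((memLp_const c).toLp _),
    Lp.coeFn_smul (character 0 t) ((memLp_const (μ := μ) (p := 2) c).toLp _),
    (measurePreserving_vadd (-t) μ).quasiMeasurePreserving.ae h] with lam h1 h2 h3 h4
  rw [h2, h3, h4, Pi.smul_apply, h1, character_comm, character_zero, one_smul]

theorem polynomial_eval (p : Polynomial ℂ) (hf : IsAlmostPeriodic μ f) :
    IsAlmostPeriodic μ fun lam => p.eval (f lam) := by
  induction p using Polynomial.induction_on' with
  | add p q hp hq => simpa only [Polynomial.eval_add] using hp.add hq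
  | monomial n c =>
    simp only [Polynomial.eval_monomial]
    refine IsAlmostPeriodic.const_mul c ?_
    induction n with
    | zero => simpa only [pow_zero] using const 1
    | succ n ih => simpa only [pow_succ] using ih.mul hf

/-- The σ-algebra of the sets with almost periodic indicator functions. -/
@[reducible] def almostPeriodicSigma (μ : Measure (PointMeasure d m)) [IsProbabilityMeasure μ]
    [ErgodicVAdd (Space d) (PointMeasure d m) μ] : MeasurableSpace (PointMeasure d m) where
  MeasurableSet' D := IsAlmostPeriodic μ (D.indicator 1)
  measurableSet_empty := by
    simpa only [indicator_empty] using const (μ := μ) 0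
  measurableSet_compl D hD := by
    refine ((const 1).add (hD.const_mul (-1))).congr (ae_of_all _ fun lam => ?_)
    by_cases h : lam ∈ D <;> simp [h]
  measurableSet_iUnion D hD := by
    -- The complement of a union has as indicator the infinite product of the `1 - 1_{D i}`, a
    -- bounded limit of finite products.
    have hprod (n : ℕ) : IsAlmostPeriodic μ
        fun lam => ∏ i ∈ Finset.range n, (1 + -1 * (D i).indicator 1 lam) := by
      induction n with
      | zero => simpa only [Finset.range_zero, Finset.prod_empty] using const 1
      | succ n ih =>
        simp only [Finset.prod_range_succ]
        exact ih.mul ((const 1).add ((hD n).const_mul (-1)))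
    have h01 (i : ℕ) (lam : PointMeasure d m) :
        ‖(1 + -1 * (D i).indicator 1 lam : ℂ)‖ ≤ 1 := by
      by_cases h : lam ∈ D i <;> simp [h]
    have hlim : IsAlmostPeriodic μ fun lam => 1 + -1 * (⋃ i, D i).indicator 1 lam := by
      refine of_tendsto (C := 1) hprod (fun n => ae_of_all _ fun lam => ?_)
        (ae_of_all _ fun lam => ?_)
      · rw [norm_prod]
        exact Finset.prod_le_one (fun _ _ => norm_nonneg _) fun i _ => h01 i lam
      · by_cases h : lam ∈ ⋃ i, D i
        · obtain ⟨i, hi⟩ := mem_iUnion.1 h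
          rw [indicator_of_mem h]
          refine tendsto_const_nhds.congr' ?_
          filter_upwards [eventually_gt_atTop i] with n hn
          rw [Finset.prod_eq_zero (Finset.mem_range.2 hn) (by simp [hi])]
          simp
        · rw [indicator_of_notMem h]
          refine tendsto_const_nhds.congr fun n => ?_
          rw [Finset.prod_eq_one fun i _ => ?_]
          · simp
          · rw [indicator_of_notMem fun hi => h (mem_iUnion.2 ⟨i, hi⟩)]
            simp
    refine ((const 1).add (hlim.const_mul (-1))).congr (ae_of_all _ fun lam => ?_)
    ring

end IsAlmostPeriodic

end AlmostPeriodic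

/-! ### Counts in small open sets. -/

section LocalCounts

variable {d m : ℕ} {r : ℝ}

/-- A map into the space of point measures is measurable if the counts of points of each colour in
small open sets are. -/
theorem measurable_of_colour_ball {α : Type*} [MeasurableSpace α] {g : α → PointMeasure d m}
    {ε : ℝ} (hε : 0 < ε) (h : ∀ (i : Fin m) (U : Set (Space d)) (a : Space d), IsOpen U →
      U ⊆ Metric.ball a ε → Measurable fun x => (g x).colour i U) : Measurable g := by
  refine measurable_of_colour fun i => Measure.measurable_of_measurable_coe _ fun A hA => ?_
  let B : ℕ → Set (Space d) := fun n => Metric.ball (TopologicalSpace.denseSeq (Space d) n) ε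
  have hB (n : ℕ) : MeasurableSet (B n) := measurableSet_ball
  have hBu : ⋃ n, B n = univ := by
    refine eq_univ_of_forall fun x => ?_
    obtain ⟨n, hn⟩ := (TopologicalSpace.denseRange_denseSeq (Space d)).exists_dist_lt x hε
    exact mem_iUnion.2 ⟨n, hn⟩
  have hfin (x : α) (n : ℕ) : IsFiniteMeasure (((g x).colour i).restrict (B n)) :=
    isFiniteMeasure_restrict.2 measure_ball_lt_top.ne
  have hres (n : ℕ) : Measurable fun x => ((g x).colour i).restrict (B n) := by
    refine Measurable.measure_of_isPiSystem (S := {s | IsOpen s}) BorelSpace.measurable_eq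
      isPiSystem_isOpen (fun U hU => ?_) ?_
    · simp only [Measure.restrict_apply' (hB n)]
      exact h i _ _ (IsOpen.inter hU Metric.isOpen_ball) inter_subset_right
    · simp only [Measure.restrict_apply_univ]
      exact h i _ _ Metric.isOpen_ball subset_rfl
  have hsum (x : α) : (g x).colour i A =
      ∑' n, ((g x).colour i).restrict (B n) (A ∩ disjointed B n) := by
    have h1 (n : ℕ) : ((g x).colour i).restrict (B n) (A ∩ disjointed B n) =
        (g x).colour i (A ∩ disjointed B n) := by
      rw [Measure.restrict_apply' (hB n), inter_assoc,
        inter_eq_left.2 (disjointed_subset B n)]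
    simp only [h1]
    rw [← measure_iUnion (fun n k hnk => ((disjoint_disjointed B hnk).mono inter_subset_right
      inter_subset_right)) fun n => hA.inter (MeasurableSet.disjointed hB n), ← inter_iUnion,
      iUnion_disjointed, hBu, inter_univ]
  simp only [hsum]
  exact Measurable.tsum fun n => (Measure.measurable_coe
    (hA.inter (MeasurableSet.disjointed hB n))).comp (hres n)

/-- A uniformly discrete point measure has at most one point in a small set. -/
theorem colour_eq_zero_or_ite {lam : PointMeasure d m} (h : lam ∈ uniformlyDiscrete d m r)
    {U : Set (Space d)} {a : Space d} (hU : MeasurableSet U) (hUa : U ⊆ Metric.ball a (r / 2)) :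
    (∀ i, lam.colour i U = 0) ∨ ∃ i₀, ∀ i, lam.colour i U = if i = i₀ then 1 else 0 := by
  have hnat (i : Fin m) : ∃ n : ℕ, lam.colour i U = n := by
    rw [PointMeasure.colour_apply]
    refine lam.exists_nat _ (hU.prod (measurableSet_singleton i)) ?_
    rw [closure_prod_eq]
    exact (Metric.isBounded_ball.subset hUa).isCompact_closure.prod
      (by rw [closure_singleton]; exact isCompact_singleton)
  have hsum : ∑ i, lam.colour i U ≤ 1 := by
    have h1 : lam.toMeasure (U ×ˢ univ) ≤ 1 := by
      refine (measure_mono ?_).trans (h a)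
      refine prod_mono (fun y hy => ⟨y - a, fun j => ?_, by simp⟩) subset_rfl
      exact (abs_apply_le_norm _ _).trans_lt (by simpa [dist_eq_norm] using hUa hy)
    refine le_trans (le_of_eq ?_) h1
    rw [PointMeasure.toMeasure_apply_eq_sum _ (hU.prod MeasurableSet.univ)]
    simp
  by_cases h0 : ∀ i, lam.colour i U = 0
  · exact Or.inl h0
  · push Not at h0
    obtain ⟨i₀, hi₀⟩ := h0
    choose n hn using hnat
    simp only [hn] at hsum hi₀ ⊢
    have hsum' : ∑ i, n i ≤ 1 := by exact_mod_cast hsum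
    have hi₀' : n i₀ ≠ 0 := by exact_mod_cast hi₀
    refine Or.inr ⟨i₀, fun i => ?_⟩
    rw [← Finset.add_sum_erase _ _ (Finset.mem_univ i₀)] at hsum'
    split_ifs with hi
    · subst hi
      have : n i = 1 := by omega
      simp [this]
    · have h2 := Finset.single_le_sum (f := n) (fun _ _ => Nat.zero_le _)
        (Finset.mem_erase.2 ⟨hi, Finset.mem_univ i⟩)
      have : n i = 0 := by omega
      simp [this]

/-- The indicator function of a bounded open set is a limit of smooth functions. -/
theorem exists_schwartz_tendsto_indicator {U : Set (Space d)} (hU : IsOpen U)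
    (hb : Bornology.IsBounded U) : ∃ f : ℕ → 𝓢(Space d, ℂ),
      (∀ n x, ‖f n x‖ ≤ U.indicator 1 x) ∧
      ∀ x, Tendsto (fun n => f n x) atTop (𝓝 (U.indicator 1 x)) := by
  obtain ⟨f, hfU, hfs, hf01⟩ := hU.exists_contDiff_support_eq (n := ⊤)
  have h01 (x : Space d) : f x ∈ Icc (0 : ℝ) 1 := hf01 (mem_range_self x)
  -- Since `f` takes values in `[0, 1]` and has support exactly `U`, the functions `1 - (1 - f)^n`
  -- tend to `1` on `U` and vanish off it.
  let φ : ℕ → Space d → ℂ := fun n x => ((1 - (1 - f x) ^ n : ℝ) : ℂ)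
  have hφ0 (n : ℕ) (x : Space d) (hx : x ∉ U) : φ n x = 0 := by
    have : f x = 0 := by rwa [← hfU, Function.notMem_support] at hx
    simp [φ, this]
  have hφc (n : ℕ) : HasCompactSupport (φ n) :=
    HasCompactSupport.of_support_subset_isCompact hb.isCompact_closure fun x hx =>
      subset_closure (not_not.1 fun hxU => hx (hφ0 n x hxU))
  have hφs (n : ℕ) : ContDiff ℝ ∞ (φ n) :=
    Complex.ofRealCLM.contDiff.comp (contDiff_const.sub ((contDiff_const.sub hfs).pow n))
  refine ⟨fun n => (hφc n).toSchwartzMap (hφs n), fun n x => ?_, fun x => ?_⟩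
  · change ‖φ n x‖ ≤ _
    by_cases hx : x ∈ U
    · rw [indicator_of_mem hx]
      change ‖((1 - (1 - f x) ^ n : ℝ) : ℂ)‖ ≤ 1
      have h1 : 0 ≤ 1 - f x := by linarith [(h01 x).2]
      have h2 : (1 - f x) ^ n ≤ 1 := pow_le_one₀ h1 (by linarith [(h01 x).1])
      rw [Complex.norm_real, Real.norm_eq_abs, abs_le]
      constructor <;> linarith [pow_nonneg h1 n]
    · rw [indicator_of_notMem hx, hφ0 n x hx, norm_zero]
  · change Tendsto (fun n => φ n x) atTop _
    by_cases hx : x ∈ U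
    · rw [indicator_of_mem hx]
      have hpos : 0 < f x := by
        rw [← hfU, Function.mem_support] at hx
        exact lt_of_le_of_ne (h01 x).1 hx.symm
      have h1 := (tendsto_pow_atTop_nhds_zero_of_lt_one (r := 1 - f x)
        (by linarith [(h01 x).2]) (by linarith)).const_sub 1
      rw [sub_zero] at h1
      exact (Complex.continuous_ofReal.tendsto' _ _ Complex.ofReal_one).comp h1
    · rw [indicator_of_notMem hx]
      exact tendsto_const_nhds.congr fun n => (hφ0 n x hx).symm

end LocalCounts

/-! ### From almost periodic counts to pure point spectrum. -/

section PurePointSpectrum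

variable {d m : ℕ} {r : ℝ} {μ : Measure (PointMeasure d m)} [IsProbabilityMeasure μ]
  {w : Fin m → ℝ}

/-- Every Schwartz function is a Fourier transform of one, so the hypothesis on `fourierCountLp`
covers all weighted counts. -/
theorem isAlmostPeriodic_weightedCount (hr : 0 < r)
    (hX : ∀ᵐ lam ∂μ, lam ∈ uniformlyDiscrete d m r)
    (hE : ∀ f, fourierCountLp hr hX w f ∈ eigenSpan μ) (f : 𝓢(Space d, ℂ)) :
    IsAlmostPeriodic μ (weightedCount w f) := by
  have h (lam : PointMeasure d m) :
      fourierCount w (FourierTransform.fourierInv f : 𝓢(Space d, ℂ)) lam =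
        weightedCount w f lam := by
    rw [fourierCount, FourierTransform.fourier_fourierInv_eq]
  obtain ⟨C, hC⟩ := exists_norm_fourierCount_le (m := m) hr w
    (FourierTransform.fourierInv f : 𝓢(Space d, ℂ))
  refine ⟨⟨C, ?_⟩, _, hE (FourierTransform.fourierInv f), ?_⟩
  · filter_upwards [hX] with lam hlam
    rw [← h]
    exact hC lam hlam _ fun _ => rfl
  · exact (coeFn_fourierCountLp hr hX w _).trans (ae_of_all _ h)

/-- A bounded limit of smooth weighted counts. Inside a ball of radius `r / 2` each colour has at
most one point, which bounds all approximants by the same constant. -/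
theorem isAlmostPeriodic_localCount (hr : 0 < r)
    (hX : ∀ᵐ lam ∂μ, lam ∈ uniformlyDiscrete d m r)
    (hE : ∀ f, fourierCountLp hr hX w f ∈ eigenSpan μ) {U : Set (Space d)} {a : Space d}
    (hU : IsOpen U) (hUa : U ⊆ Metric.ball a (r / 2)) :
    IsAlmostPeriodic μ fun lam => ∑ j, (w j : ℂ) * ((lam.colour j).real U : ℂ) := by
  have hb := Metric.isBounded_ball.subset hUa
  obtain ⟨f, hf, hlim⟩ := exists_schwartz_tendsto_indicator hU hb
  have hint (lam : PointMeasure d m) (j : Fin m) :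
      Integrable (U.indicator (1 : Space d → ℝ)) (lam.colour j) :=
    (integrable_indicator_iff hU.measurableSet).2 (integrableOn_const
      (measure_ne_top_of_subset hUa measure_ball_lt_top.ne))
  refine IsAlmostPeriodic.of_tendsto (C := ∑ j, |w j|)
    (fun n => isAlmostPeriodic_weightedCount hr hX hE (f n)) (fun n => ?_)
    (ae_of_all _ fun lam => tendsto_finsetSum _ fun j _ => Tendsto.const_mul _ ?_)
  · filter_upwards [hX] with lam hlam
    refine norm_sum_le_of_le _ fun j _ => ?_
    rw [norm_mul, Complex.norm_real, Real.norm_eq_abs]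
    refine mul_le_of_le_one_right (abs_nonneg _) ?_
    refine (norm_integral_le_of_norm_le (hint lam j) (ae_of_all _ (hf n))).trans ?_
    rw [integral_indicator_one hU.measurableSet]
    exact ENNReal.toReal_le_of_le_ofReal zero_le_one
      (by simpa using (measure_mono hUa).trans (colour_ball_le hlam j a))
  · have h1 : ∫ x, U.indicator (1 : Space d → ℂ) x ∂(lam.colour j) =
        ((lam.colour j).real U : ℂ) := by
      rw [integral_indicator hU.measurableSet]
      simp
    rw [← h1]
    exact tendsto_integral_of_dominated_convergence _
      (fun n => (f n).continuous.aestronglyMeasurable) (hint lam j)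
      (fun n => ae_of_all _ (hf n)) (ae_of_all _ hlim)

variable [ErgodicVAdd (Space d) (PointMeasure d m) μ]

/-- The colours can be recovered from the weighted counts, since the weights are distinct. -/
theorem isAlmostPeriodic_indicator_colour (hr : 0 < r)
    (hX : ∀ᵐ lam ∂μ, lam ∈ uniformlyDiscrete d m r) (hw : Function.Injective w)
    (hw0 : ∀ i, w i ≠ 0) (hE : ∀ f, fourierCountLp hr hX w f ∈ eigenSpan μ)
    {U : Set (Space d)} {a : Space d} (hU : IsOpen U) (hUa : U ⊆ Metric.ball a (r / 2))
    (i : Fin m) : IsAlmostPeriodic μ ({lam | lam.colour i U = 1}.indicator 1) := by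
  -- The interpolation nodes are the possible values of the local weighted count: `0` for no point
  -- and `w j` for a point of colour `j`. They are distinct because the weights are distinct and
  -- nonzero.
  let v : Option (Fin m) → ℂ := fun o => o.elim 0 fun j => (w j : ℂ)
  have hv : Function.Injective v := by
    rintro (_ | j) (_ | k) h
    · rfl
    · exact absurd (Complex.ofReal_eq_zero.1 h.symm) (hw0 k)
    · exact absurd (Complex.ofReal_eq_zero.1 h) (hw0 j)
    · exact congrArg some (hw (Complex.ofReal_injective h))
  have hp (o : Option (Fin m)) :
      (Lagrange.basis Finset.univ v (some i)).eval (v o) = if o = some i then 1 else 0 := by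
    split_ifs with h
    · rw [h, Lagrange.eval_basis_self hv.injOn (Finset.mem_univ _)]
    · exact Lagrange.eval_basis_of_ne (Ne.symm h) (Finset.mem_univ _)
  refine ((isAlmostPeriodic_localCount hr hX hE hU hUa).polynomial_eval
    (Lagrange.basis Finset.univ v (some i))).congr ?_
  filter_upwards [hX] with lam hlam
  rcases colour_eq_zero_or_ite hlam hU.measurableSet hUa with h | ⟨i₀, h⟩
  · have h1 : ∑ j, (w j : ℂ) * ((lam.colour j).real U : ℂ) = v none := by
      simp [Measure.real, h, v]
    rw [h1, hp, if_neg (by simp), indicator_of_notMem (by simp [h])]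
  · have h1 : ∑ j, (w j : ℂ) * ((lam.colour j).real U : ℂ) = v (some i₀) := by
      rw [Finset.sum_eq_single i₀ (fun j _ hj => by simp [Measure.real, h, hj]) (by simp)]
      simp [Measure.real, h, v]
    rw [h1, hp]
    by_cases hi : i = i₀
    · subst hi
      rw [if_pos rfl, indicator_of_mem (by simp [h]), Pi.one_apply]
    · rw [if_neg (by simpa using Ne.symm hi), indicator_of_notMem (by simp [h, hi])]

theorem measurable_ite_one_zero {α : Type*} [MeasurableSpace α] {β : Type*} [MeasurableSpace β]
    [Zero β] [One β] {p : α → Prop} [DecidablePred p]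
    (h : MeasurableSet {a | p a}) :
    Measurable fun a => if p a then (1 : β) else 0 :=
  Measurable.ite h measurable_const measurable_const

/-- The count almost surely equals the indicator of the event that it is `1`. Almost periodicity of
an indicator depends only on its class modulo null sets, so the exceptional configurations do no
harm. -/
theorem measurable_almostPeriodicSigma_colour (hr : 0 < r)
    (hX : ∀ᵐ lam ∂μ, lam ∈ uniformlyDiscrete d m r) (hw : Function.Injective w)
    (hw0 : ∀ i, w i ≠ 0) (hE : ∀ f, fourierCountLp hr hX w f ∈ eigenSpan μ)
    {U : Set (Space d)} {a : Space d} (hU : IsOpen U) (hUa : U ⊆ Metric.ball a (r / 2))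
    (i : Fin m) : Measurable[IsAlmostPeriodic.almostPeriodicSigma μ]
      fun lam : PointMeasure d m => lam.colour i U := by
  intro A hA
  have h1 : MeasurableSet[IsAlmostPeriodic.almostPeriodicSigma μ]
      {lam : PointMeasure d m | lam.colour i U = 1} :=
    isAlmostPeriodic_indicator_colour hr hX hw hw0 hE hU hUa i
  have h2 : Measurable[IsAlmostPeriodic.almostPeriodicSigma μ]
      fun lam : PointMeasure d m => if lam.colour i U = 1 then (1 : ℝ≥0∞) else 0 :=
    @measurable_ite_one_zero _ (IsAlmostPeriodic.almostPeriodicSigma μ) _ _ _ _ _ _ h1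
  refine IsAlmostPeriodic.congr (h2 hA) ?_
  filter_upwards [hX] with lam hlam
  have h3 : (if lam.colour i U = 1 then (1 : ℝ≥0∞) else 0) = lam.colour i U := by
    rcases colour_eq_zero_or_ite hlam hU.measurableSet hUa with h | ⟨i₀, h⟩
    · simp [h]
    · rw [h]
      by_cases hi : i = i₀ <;> simp [hi]
  have h4 : lam ∈ (fun lam : PointMeasure d m => if lam.colour i U = 1 then (1 : ℝ≥0∞) else 0) ⁻¹' A ↔
      lam ∈ (fun lam : PointMeasure d m => lam.colour i U) ⁻¹' A := by
    rw [mem_preimage, mem_preimage, h3]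
  by_cases h5 : lam ∈ (fun lam : PointMeasure d m => lam.colour i U) ⁻¹' A
  · rw [indicator_of_mem h5, indicator_of_mem (h4.2 h5)]
  · rw [indicator_of_notMem h5, indicator_of_notMem (mt h4.1 h5)]

/-- If the weighted counts are almost periodic, then the spectrum is pure point. -/
theorem hasPurePointSpectrum_of_fourierCountLp (hr : 0 < r)
    (hX : ∀ᵐ lam ∂μ, lam ∈ uniformlyDiscrete d m r) (hw : Function.Injective w)
    (hw0 : ∀ i, w i ≠ 0) (hE : ∀ f, fourierCountLp hr hX w f ∈ eigenSpan μ) :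
    HasPurePointSpectrum μ := by
  -- Measurability of the identity from the almost periodic σ-algebra to the Borel one says that
  -- every Borel set is almost periodic.
  have hid : @Measurable _ _ (IsAlmostPeriodic.almostPeriodicSigma μ) _
      (id : PointMeasure d m → PointMeasure d m) :=
    @measurable_of_colour_ball d m _ (IsAlmostPeriodic.almostPeriodicSigma μ) id _ (half_pos hr)
      fun i U a hU hUa => measurable_almostPeriodicSigma_colour hr hX hw hw0 hE hU hUa i
  have hset (D : Set (PointMeasure d m)) (hD : MeasurableSet D) :
      IsAlmostPeriodic μ (D.indicator 1) := hid hD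
  rw [HasPurePointSpectrum, Submodule.dense_iff_topologicalClosure_eq_top]
  change eigenSpan μ = ⊤
  have : CompleteSpace (eigenSpan μ) := (isClosed_eigenSpan (μ := μ)).completeSpace_coe
  rw [← Submodule.orthogonal_eq_bot_iff, Submodule.eq_bot_iff]
  intro G hG
  rw [Lp.eq_zero_iff_ae_eq_zero]
  -- A vector orthogonal to the span has zero integral over every Borel set, because the indicators
  -- of these sets lie in the span.
  refine Integrable.ae_eq_zero_of_forall_setIntegral_eq_zero
    ((Lp.memLp G).integrable (by norm_num)) fun D hD _ => ?_
  obtain ⟨F, hFE, hF⟩ := (hset D hD).mem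
  have h1 := hG F hFE
  have h2 : F = indicatorConstLp 2 hD (measure_ne_top μ D) (1 : ℂ) :=
    Lp.ext (hF.trans indicatorConstLp_coeFn.symm)
  rwa [h2, L2.inner_indicatorConstLp_one hD (measure_ne_top μ D) G] at h1

end PurePointSpectrum

end PointProc

end

theorem mainTheorem6 (d m : ℕ) (μ : Measure (PointProc.PointMeasure d m))
    [IsProbabilityMeasure μ]
    (r : ℝ) (hr : 0 < r) (hX : μ.support ⊆ PointProc.uniformlyDiscrete d m r)
    (hErg : ErgodicVAdd (PointProc.Space d) (PointProc.PointMeasure d m) μ)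
    (hI : ∀ i, 0 < PointProc.intensity μ i)
    (w : Fin m → ℝ) (hw : Function.Injective w) (hw0 : ∀ i, w i ≠ 0) :
    (∃! ν : Measure (PointProc.Space d), PointProc.IsDiffraction μ w ν) ∧
      ∀ ν : Measure (PointProc.Space d), PointProc.IsDiffraction μ w ν →
        (PointProc.IsPurePoint ν ↔ PointProc.HasPurePointSpectrum μ) := by
  have hX' := PointProc.ae_mem_uniformlyDiscrete hX
  refine ⟨PointProc.existsUnique_isDiffraction hr hX' w, fun ν hν => ?_⟩
  have := hν.locallyFinite
  have := hν.hasTemperateGrowth hr hX'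
  obtain ⟨θ, hθ, hcomm⟩ := hν.exists_isometry hr hX'
  refine ⟨fun h => ?_, PointProc.isPurePoint_of_isometry θ hcomm⟩
  refine PointProc.hasPurePointSpectrum_of_fourierCountLp hr hX' hw hw0 fun f => ?_
  rw [← hθ]
  exact PointProc.isometry_mem_eigenSpan θ hcomm h _
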